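/- **Theorem.** There is a deterministic algorithm $\mathcal{P}$ with access to oracles, and a polynomial $p$, such that the following holds for all integers $n\ge 1$, $m\ge 0$, $B\ge 0$. Let $\mathcal{M}$ be a set of $m$ items, and let $n$ agents have valuations $V_1,\dots,V_n : 2^{\mathcal{M}}\to\mathbb{Q}_{\ge 0}$ that are monotone and XOS (fractionally subadditive), i.e. each $V_i$ is the pointwise maximum of finitely many additive functions $S\mapsto\sum_{e\in S} g(e)$. Suppose that each $V_i$ is given only through * a demand oracle, which on prices $(p_e)_{e\in\mathcal{M}}$ returns a set $S$ maximizing $V_i(S)-\sum_{e\in S}p_e$ (with arbitrary choice among the maximizers), and * an XOS oracle, which on a set $S$ returns contributions $(c_e)_{e\in S}$ of its items to $V_i(S)$, i.e. rational numbers with $\sum_{e\in S}c_e=V_i(S)$ and $\sum_{e\in T}c_e\le V_i(T)$ for all $T\subseteq S$, and that every number returned by the XOS oracles has bit length at most $B$. Then $\mathcal{P}$, given only $n$, $m$ and the oracles, outputs within time $p(n+m+B)$ a partition $(A_1,\dots,A_n)$ of $\mathcal{M}$ (parts may be empty) such that for every $i$ $$V_i(A_i)\ \ge\ \tfrac18\,\mathsf{MMS}_i,\qquad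 \mathsf{MMS}_i=\max_{(P_1,\dots,P_n)}\ \min_{1\le j\le n} V_i(P_j),$$ where the maximum is over all partitions of $\mathcal{M}$ into $n$ (possibly empty) sets. Here an algorithm is a single program (the same for all $n$, $m$, valuations and oracles) of a random access machine on rational numbers under the logarithmic cost criterion: each operation is charged the bit lengths of the numbers it reads and produces, and each oracle query is charged the bit lengths of the query and of the answer. -/

import Mathlib

namespace FairAllocation

/-! ### Valuations, maxmin values, allocations -/

/-- `V` is the pointwise maximum of a finite (nonempty) family of additive set functions,
each given by the values of the single items. -/
def IsXOS {m : ℕ} (V : Finset (Fin m) → ℚ) : Prop :=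
  ∃ (k : ℕ) (g : Fin k → Fin m → ℚ),
    ∀ S, IsGreatest (Set.range fun l => ∑ e ∈ S, g l e) (V S)

/-- The valuation of an XOS agent: nonnegative, monotone and XOS. -/
structure IsXOSValuation {m : ℕ} (V : Finset (Fin m) → ℚ) : Prop where
  nonneg : ∀ S, 0 ≤ V S
  mono : ∀ S T, max (V S) (V T) ≤ V (S ∪ T)
  xos : IsXOS V

/-- The `j`-th set of the partition of the items that puts item `e` into set number `P e`.
Sets may be empty. -/
def bundle {m r : ℕ} (P : Fin m → Fin r) (j : Fin r) : Finset (Fin m) :=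
  Finset.univ.filter fun e => P e = j

/-- The maxmin value: the maximum over all partitions of the items into `r` sets of the
minimum value of a set of the partition. -/
def mms {m : ℕ} (V : Finset (Fin m) → ℚ) (r : ℕ) [NeZero r] : ℚ :=
  Finset.univ.sup' Finset.univ_nonempty fun P : Fin m → Fin r =>
    Finset.univ.inf' Finset.univ_nonempty fun j : Fin r => V (bundle P j)

/-- The allocation that gives item `e` to agent `A e` is `α`-MMS. -/
def IsMMSAllocation {n m : ℕ} [NeZero n] (α : ℚ) (V : Fin n → Finset (Fin m) → ℚ)
    (A : Fin m → Fin n) : Prop :=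
  ∀ i, α * mms (V i) n ≤ V i (bundle A i)

/-! ### Oracles -/

/-- `D` answers every price vector `p` with a set that maximizes value minus price. -/
def IsDemandOracle {m : ℕ} (V : Finset (Fin m) → ℚ)
    (D : (Fin m → ℚ) → Finset (Fin m)) : Prop :=
  ∀ p T, V T - ∑ e ∈ T, p e ≤ V (D p) - ∑ e ∈ D p, p e

/-- `X` answers every set `S` with the contributions `X S e` of the items `e ∈ S` to `V S`:
they are the values of the items of `S` under an additive function that is dominated by `V`
and agrees with `V` on `S`. Any additive function of an XOS representation of `V` that attains
the maximum at `S` is a possible answer. -/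
def IsXOSOracle {m : ℕ} (V : Finset (Fin m) → ℚ)
    (X : Finset (Fin m) → Fin m → ℚ) : Prop :=
  ∀ S, ∑ e ∈ S, X S e = V S ∧ ∀ T ⊆ S, ∑ e ∈ T, X S e ≤ V T

/-- A demand oracle and an XOS oracle for each of `n` agents. -/
structure Oracles (n m : ℕ) where
  demand : Fin n → (Fin m → ℚ) → Finset (Fin m)
  xos : Fin n → Finset (Fin m) → Fin m → ℚ

/-! ### Machine model

While-programs over a random access memory of rational numbers, with logarithmic cost: every
operation is charged the bit lengths of the numbers that it reads and produces. -/

/-- Bit length of a rational number in lowest terms. -/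
def bitSize (q : ℚ) : ℕ := q.num.natAbs.size + q.den.size

/-- The memory: arrays with names in `ℕ`, each indexed by `ℕ`. -/
abbrev Memory := ℕ → ℕ → ℚ

inductive Expr where
  | const (q : ℚ)
  | read (x : ℕ) (idx : Expr)
  | add (a b : Expr)
  | sub (a b : Expr)
  | mul (a b : Expr)
  | div (a b : Expr)

/-- Value of an expression. Array indices are rounded down to a natural number, and a quotient
by zero is zero. -/
def Expr.eval (σ : Memory) : Expr → ℚ
  | const q => q
  | read x idx => σ x ⌊idx.eval σ⌋₊
  | add a b => a.eval σ + b.eval σ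
  | sub a b => a.eval σ - b.eval σ
  | mul a b => a.eval σ * b.eval σ
  | div a b => a.eval σ / b.eval σ

/-- Cost of evaluating an expression. -/
def Expr.cost (σ : Memory) : Expr → ℕ
  | const q => 1 + bitSize q
  | read x idx => idx.cost σ + (1 + bitSize (idx.eval σ) + bitSize ((read x idx).eval σ))
  | add a b => a.cost σ + b.cost σ +
      (1 + bitSize (a.eval σ) + bitSize (b.eval σ) + bitSize ((add a b).eval σ))
  | sub a b => a.cost σ + b.cost σ +
      (1 + bitSize (a.eval σ) + bitSize (b.eval σ) + bitSize ((sub a b).eval σ))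
  | mul a b => a.cost σ + b.cost σ +
      (1 + bitSize (a.eval σ) + bitSize (b.eval σ) + bitSize ((mul a b).eval σ))
  | div a b => a.cost σ + b.cost σ +
      (1 + bitSize (a.eval σ) + bitSize (b.eval σ) + bitSize ((div a b).eval σ))

/-- Programs: assignment `x[idx] := e`, sequencing, the conditional and the loop on `a ≤ b`, and
the oracle queries. `demand i p out` asks the demand oracle of agent `i` at the prices in array
`p` and stores the answer in array `out` as a 0-1 vector; `xos i s out` asks the XOS oracle of
agent `i` at the set of the items whose entries in array `s` are nonzero and stores the
contributions in array `out`. -/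
inductive Program where
  | skip
  | assign (x : ℕ) (idx e : Expr)
  | seq (c d : Program)
  | ite (a b : Expr) (c d : Program)
  | while (a b : Expr) (c : Program)
  | demand (i : Expr) (p out : ℕ)
  | xos (i : Expr) (s out : ℕ)

/-- Store `q` in `x[k]`. -/
def Memory.set (σ : Memory) (x k : ℕ) (q : ℚ) : Memory :=
  fun y l => if y = x ∧ l = k then q else σ y l

/-- Store the vector `f` in `x[0], …, x[m-1]`. -/
def Memory.setVec {m : ℕ} (σ : Memory) (x : ℕ) (f : Fin m → ℚ) : Memory :=
  fun y l => if h : y = x ∧ l < m then f ⟨l, h.2⟩ else σ y l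

/-- The vector in `x[0], …, x[m-1]`. -/
def Memory.vec (m : ℕ) (σ : Memory) (x : ℕ) : Fin m → ℚ := fun j => σ x j

/-- Total bit length of a vector. -/
def vecSize {m : ℕ} (f : Fin m → ℚ) : ℕ := ∑ j, bitSize (f j)

/-- The answer to a demand query, as a 0-1 vector. -/
def Oracles.demandVec {n m : ℕ} (O : Oracles n m) (i : Fin n) (p : Fin m → ℚ) : Fin m → ℚ :=
  fun j => if j ∈ O.demand i p then 1 else 0

/-- The answer to an XOS query at the set of the nonzero entries of `s`; the entries of the items
outside that set are zero. -/
def Oracles.xosVec {n m : ℕ} (O : Oracles n m) (i : Fin n) (s : Fin m → ℚ) : Fin m → ℚ :=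
  fun j => if s j ≠ 0 then O.xos i (Finset.univ.filter fun e => s e ≠ 0) j else 0

/-- `Exec O c σ t τ`: started in memory `σ`, program `c` halts in memory `τ` after time `t`.
A query addressed to a nonexistent agent blocks. -/
inductive Exec {n m : ℕ} (O : Oracles n m) : Program → Memory → ℕ → Memory → Prop
  | skip (σ) : Exec O .skip σ 1 σ
  | assign (x idx e σ) :
      Exec O (.assign x idx e) σ (idx.cost σ + e.cost σ + 1)
        (σ.set x ⌊idx.eval σ⌋₊ (e.eval σ))
  | seq {c d σ t τ u ρ} (hc : Exec O c σ t τ) (hd : Exec O d τ u ρ) :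
      Exec O (.seq c d) σ (t + u) ρ
  | ite_true {a b c d σ t τ} (h : a.eval σ ≤ b.eval σ) (hc : Exec O c σ t τ) :
      Exec O (.ite a b c d) σ (a.cost σ + b.cost σ + 1 + t) τ
  | ite_false {a b c d σ t τ} (h : ¬ a.eval σ ≤ b.eval σ) (hd : Exec O d σ t τ) :
      Exec O (.ite a b c d) σ (a.cost σ + b.cost σ + 1 + t) τ
  | while_true {a b c σ t τ u ρ} (h : a.eval σ ≤ b.eval σ) (hc : Exec O c σ t τ)
      (hw : Exec O (.while a b c) τ u ρ) :
      Exec O (.while a b c) σ (a.cost σ + b.cost σ + 1 + t + u) ρ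
  | while_false {a b c σ} (h : ¬ a.eval σ ≤ b.eval σ) :
      Exec O (.while a b c) σ (a.cost σ + b.cost σ + 1) σ
  | demand {e p out σ} (i : Fin n) (h : ⌊e.eval σ⌋₊ = i) :
      Exec O (.demand e p out) σ
        (e.cost σ + 1 + vecSize (σ.vec m p) + vecSize (O.demandVec i (σ.vec m p)))
        (σ.setVec out (O.demandVec i (σ.vec m p)))
  | xos {e s out σ} (i : Fin n) (h : ⌊e.eval σ⌋₊ = i) :
      Exec O (.xos e s out) σ
        (e.cost σ + 1 + vecSize (σ.vec m s) + vecSize (O.xosVec i (σ.vec m s)))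
        (σ.setVec out (O.xosVec i (σ.vec m s)))

/-- Running time and final memory are determined by the program, its input and the oracles. -/
theorem Exec.deterministic {n m : ℕ} {O : Oracles n m} {c : Program} {σ τ τ' : Memory} {t t' : ℕ}
    (h : Exec O c σ t τ) (h' : Exec O c σ t' τ') : t = t' ∧ τ = τ' := by
  induction h generalizing t' τ' with
  | skip => cases h'; exact ⟨rfl, rfl⟩
  | assign => cases h'; exact ⟨rfl, rfl⟩
  | seq _ _ ih₁ ih₂ =>
    cases h' with
    | seq h₁ h₂ =>
      obtain ⟨rfl, rfl⟩ := ih₁ h₁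
      obtain ⟨rfl, rfl⟩ := ih₂ h₂
      exact ⟨rfl, rfl⟩
  | ite_true h _ ih =>
    cases h' with
    | ite_true _ h₁ => obtain ⟨rfl, rfl⟩ := ih h₁; exact ⟨rfl, rfl⟩
    | ite_false h₀ _ => exact absurd h h₀
  | ite_false h _ ih =>
    cases h' with
    | ite_true h₀ _ => exact absurd h₀ h
    | ite_false _ h₁ => obtain ⟨rfl, rfl⟩ := ih h₁; exact ⟨rfl, rfl⟩
  | while_true h _ _ ih₁ ih₂ =>
    cases h' with
    | while_true _ h₁ h₂ =>
      obtain ⟨rfl, rfl⟩ := ih₁ h₁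
      obtain ⟨rfl, rfl⟩ := ih₂ h₂
      exact ⟨rfl, rfl⟩
    | while_false h₀ => exact absurd h h₀
  | while_false h =>
    cases h' with
    | while_true h₀ _ _ => exact absurd h₀ h
    | while_false _ => exact ⟨rfl, rfl⟩
  | demand i h =>
    cases h' with
    | demand i' h₁ =>
      obtain rfl : i = i' := Fin.ext (h.symm.trans h₁)
      exact ⟨rfl, rfl⟩
  | xos i h =>
    cases h' with
    | xos i' h₁ =>
      obtain rfl : i = i' := Fin.ext (h.symm.trans h₁)
      exact ⟨rfl, rfl⟩

/-- The initial memory: `n` in `0[0]`, `m` in `1[0]`, and zero everywhere else. -/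
def inputMemory (n m : ℕ) : Memory :=
  fun x k => if x = 0 ∧ k = 0 then (n : ℚ) else if x = 1 ∧ k = 0 then (m : ℚ) else 0

/-- Array `0` of the final memory lists the agents that the items are allocated to. -/
def IsOutput {n m : ℕ} (τ : Memory) (A : Fin m → Fin n) : Prop :=
  ∀ j : Fin m, τ 0 j = ((A j : ℕ) : ℚ)

end FairAllocation

/-! The algorithm is a local search. Each agent `i` has a unit `u i` with `mms (V i) n ≤ 8 * u i`,
so it suffices that every agent ends with a bundle worth one unit (`Inv.isMMSAllocation`). The first
unit is `m` times the `n`-th largest value `w i` of a single item. This is safe because `w i ≤ mms ≤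
m * w i`: `n` items of value `w i` can be spread over the parts, and some part contains none of the
fewer than `n` items of larger value (`le_mms_of_card_le`, `mms_le_of_card_lt`).

A state records owners and contributions `C e`, measured in units of the owner; all loads are below
3. In a round, an agent `i` with load below 1 takes a single free item worth a unit, if there is
one; the item then has contribution 1 and is permanent, and its owner has load exactly 1. Otherwise
`i` demands a set at prices `(2 + 1/n) * u i * C e`, with prohibitive prices on permanent items.
Every demanded item contributes at least its price and less than a unit, so if the demanded set is
worth two units it can be trimmed to a total in `[2, 3)` units.

The central estimate is `Inv.two_mul_le_demand`. Suppose `mms ≥ (8 - 1/n) * u i` and take a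
partition that witnesses it. Discard the parts with permanent items; at least as many parts remain
as there are agents without permanent items. The load of those agents is at most 3 each, and 2 less
in total because `i` has less than 1. Hence some remaining part has total contribution at most `3 -
2/n` and costs at most `(2 + 1/n) * (3 - 2/n) ≤ 6 - 1/n` units. It leaves a surplus of 2 units, so
the demanded set is worth at least 2. If the demanded set is worth less, the guess was too high and
the unit is multiplied by `1 - 1/(8n)`, which preserves `mms ≤ 8 * u i`.

Termination comes from `potential`. A trimmed gift of total at least 2 units displaces at most the
fraction `n/(2n+1)` of its own total, and `i` gives up less than 1, so the sum of contributions
grows by at least `1/(2n+1)` (`Gift.potential_give`). New permanent items and reductions carry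
weights that outweigh what they destroy. There are at most `64 n m` reductions per agent, because `w
i ≤ mms` bounds the unit from below (`Inv.reduce`). So polynomially many rounds suffice
(`Inv.potential_lt`).

For the running time, the numbers must stay short. Units have the closed form `m * w * (1 - 1/(8n))
^ f` with polynomially bounded `f`, and contributions are oracle answers or units divided by units;
no height accumulates from round to round. Given such bounds, `Program.time` reads a time bound off
the program text, and `Run` is a total-correctness triple that carries this bound along. -/

namespace FairAllocation

/-! ### Heights of rational numbers -/

/-- The larger of the bit lengths of numerator and denominator. -/
def ht (q : ℚ) : ℕ := max q.num.natAbs.size q.den.size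

/-- Heights replace bit sizes at the price of a factor 2, because the four arithmetic operations
then all obey the same bound: sum of the heights plus one. -/
theorem bitSize_le_ht (q : ℚ) : bitSize q ≤ 2 * ht q := by
  unfold bitSize ht; omega

theorem ht_le_bitSize (q : ℚ) : ht q ≤ bitSize q := by
  unfold bitSize ht; omega

theorem size_mul_le (a b : ℕ) : (a * b).size ≤ a.size + b.size := by
  rw [Nat.size_le, pow_add]
  exact Nat.mul_lt_mul'' (Nat.lt_size_self a) (Nat.lt_size_self b)

theorem size_le_self_add_one (k : ℕ) : k.size ≤ k + 1 :=
  Nat.size_le.2 (Nat.lt_two_pow_self.trans (Nat.pow_lt_pow_right (by norm_num) (by omega)))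

/-- Cancelling common factors only shrinks numerator and denominator, so any representation as a
fraction bounds the height. -/
theorem ht_le_of_divInt {a b : ℤ} {q : ℚ} (hb : b ≠ 0) (h : q = (a : ℚ) / b) {K : ℕ}
    (ha : a.natAbs.size ≤ K) (hbK : b.natAbs.size ≤ K) : ht q ≤ K := by
  have hq : q = Rat.divInt a b := by rw [h, Rat.divInt_eq_div]
  have hd : (q.den : ℤ) ∣ b := hq ▸ Rat.den_dvd a b
  refine max_le ?_ ?_
  · by_cases ha0 : a = 0
    · simp [h, ha0]
    · have hn : q.num ∣ a := hq ▸ Rat.num_dvd a hb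
      exact (Nat.size_le_size (Nat.le_of_dvd (Int.natAbs_pos.2 ha0)
        (Int.natAbs_dvd_natAbs.2 hn))).trans ha
  · refine (Nat.size_le_size (Nat.le_of_dvd (Int.natAbs_pos.2 hb) ?_)).trans hbK
    simpa using Int.natAbs_dvd_natAbs.2 hd

theorem ht_mul (a b : ℚ) : ht (a * b) ≤ ht a + ht b := by
  refine ht_le_of_divInt (a := a.num * b.num) (b := a.den * b.den)
    (by simp) ?_ ?_ ?_
  · push_cast
    rw [mul_div_mul_comm, Rat.num_div_den, Rat.num_div_den]
  · rw [Int.natAbs_mul]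
    exact (size_mul_le _ _).trans (add_le_add (le_max_left _ _) (le_max_left _ _))
  · rw [Int.natAbs_mul]
    exact (size_mul_le _ _).trans (add_le_add (le_max_right _ _) (le_max_right _ _))

theorem ht_inv (a : ℚ) : ht a⁻¹ ≤ ht a := by
  by_cases h : a = 0
  · simp [h]
  · refine ht_le_of_divInt (a := a.den) (b := a.num) (by simpa) ?_ ?_ ?_
    · push_cast
      rw [← inv_div, Rat.num_div_den]
    · exact le_max_right _ _
    · exact le_max_left _ _

theorem ht_div (a b : ℚ) : ht (a / b) ≤ ht a + ht b := by
  rw [div_eq_mul_inv]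
  exact (ht_mul _ _).trans (Nat.add_le_add_left (ht_inv b) _)

theorem size_add_le {a b K : ℕ} (ha : a.size ≤ K) (hb : b.size ≤ K) : (a + b).size ≤ K + 1 := by
  rw [Nat.size_le] at *
  rw [pow_succ]; omega

theorem ht_add (a b : ℚ) : ht (a + b) ≤ ht a + ht b + 1 := by
  have ha : a.num.natAbs.size ≤ ht a := le_max_left _ _
  have hb : b.num.natAbs.size ≤ ht b := le_max_left _ _
  have ha' : a.den.size ≤ ht a := le_max_right _ _
  have hb' : b.den.size ≤ ht b := le_max_right _ _
  refine ht_le_of_divInt (a := a.num * b.den + b.num * a.den) (b := a.den * b.den)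
    (by simp) ?_ ?_ ?_
  · push_cast
    conv_lhs => rw [← Rat.num_div_den a, ← Rat.num_div_den b]
    have := a.den_nz
    have := b.den_nz
    field_simp
  · refine (Nat.size_le_size (Int.natAbs_add_le _ _)).trans (size_add_le ?_ ?_)
    · rw [Int.natAbs_mul]
      exact (size_mul_le _ _).trans (add_le_add ha hb')
    · rw [Int.natAbs_mul, add_comm (ht a)]
      exact (size_mul_le _ _).trans (add_le_add hb ha')
  · rw [Int.natAbs_mul]
    exact ((size_mul_le _ _).trans (add_le_add ha' hb')).trans (Nat.le_succ _)

theorem ht_neg (a : ℚ) : ht (-a) = ht a := by simp [ht]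

theorem ht_sub (a b : ℚ) : ht (a - b) ≤ ht a + ht b + 1 := by
  rw [sub_eq_add_neg]
  exact (ht_add _ _).trans (by rw [ht_neg])

theorem ht_natCast (k : ℕ) : ht (k : ℚ) ≤ k + 1 := by
  simp [ht, size_le_self_add_one]

theorem ht_zero : ht 0 = 1 := by simp [ht]

theorem ht_one : ht 1 = 1 := by simp [ht]

theorem ht_ofNat (k : ℕ) [k.AtLeastTwo] : ht (OfNat.ofNat k) ≤ k + 1 := ht_natCast k

theorem ht_pow (q : ℚ) (k : ℕ) : ht (q ^ k) ≤ k * ht q + 1 := by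
  induction k with
  | zero => simp [ht_one]
  | succ k ih =>
    rw [pow_succ]
    refine (ht_mul _ _).trans ?_
    rw [Nat.succ_mul]; omega

/-- Linear growth in the number of terms is the price of multiplying denominators. It is harmless
because the algorithm only sums over items. -/
theorem ht_sum {ι : Type*} (s : Finset ι) (f : ι → ℚ) {K : ℕ} (hf : ∀ e ∈ s, ht (f e) ≤ K) :
    ht (∑ e ∈ s, f e) ≤ s.card * (K + 1) + 1 := by
  classical
  induction s using Finset.induction_on with
  | empty => simp [ht_zero]
  | insert a s ha ih =>
    rw [Finset.sum_insert ha, Finset.card_insert_of_notMem ha, Nat.succ_mul]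
    have h1 := ih fun e he => hf e (Finset.mem_insert_of_mem he)
    have h2 := hf a (Finset.mem_insert_self _ _)
    have := ht_add (f a) (∑ e ∈ s, f e)
    omega

/-! ### Time bounds that are read off the program text -/

/-- Every entry of array `x` has height at most `κ x`. -/
def Fits (κ : ℕ → ℕ) (σ : Memory) : Prop := ∀ x k, ht (σ x k) ≤ κ x

/-- Bound for the height of the value of an expression in a memory that fits `κ`. -/
def Expr.hb (κ : ℕ → ℕ) : Expr → ℕ
  | const q => ht q
  | read x _ => κ x
  | add a b => a.hb κ + b.hb κ + 1
  | sub a b => a.hb κ + b.hb κ + 1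
  | mul a b => a.hb κ + b.hb κ + 1
  | div a b => a.hb κ + b.hb κ + 1

theorem Expr.ht_eval_le {κ : ℕ → ℕ} {σ : Memory} (h : Fits κ σ) (e : Expr) :
    ht (e.eval σ) ≤ e.hb κ := by
  induction e with
  | const q => exact le_rfl
  | read x idx => exact h _ _
  | add a b iha ihb => have := ht_add (a.eval σ) (b.eval σ); simp only [eval, hb]; omega
  | sub a b iha ihb => have := ht_sub (a.eval σ) (b.eval σ); simp only [eval, hb]; omega
  | mul a b iha ihb => have := ht_mul (a.eval σ) (b.eval σ); simp only [eval, hb]; omega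
  | div a b iha ihb => have := ht_div (a.eval σ) (b.eval σ); simp only [eval, hb]; omega

/-- Bound for the cost of an expression in a memory whose entries have height at most `K`. -/
def Expr.cb (K : ℕ) : Expr → ℕ
  | const q => 1 + 2 * ht q
  | read _ idx => idx.cb K + (1 + 2 * idx.hb (fun _ => K) + 2 * K)
  | add a b => a.cb K + b.cb K + (3 + 4 * a.hb (fun _ => K) + 4 * b.hb (fun _ => K))
  | sub a b => a.cb K + b.cb K + (3 + 4 * a.hb (fun _ => K) + 4 * b.hb (fun _ => K))
  | mul a b => a.cb K + b.cb K + (3 + 4 * a.hb (fun _ => K) + 4 * b.hb (fun _ => K))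
  | div a b => a.cb K + b.cb K + (3 + 4 * a.hb (fun _ => K) + 4 * b.hb (fun _ => K))

theorem Expr.cost_le {K : ℕ} {σ : Memory} (h : Fits (fun _ => K) σ) (e : Expr) :
    e.cost σ ≤ e.cb K := by
  have key (a : Expr) : bitSize (a.eval σ) ≤ 2 * a.hb fun _ => K :=
    (bitSize_le_ht _).trans (Nat.mul_le_mul_left _ (a.ht_eval_le h))
  induction e with
  | const q => have := bitSize_le_ht q; simp only [cost, cb]; omega
  | read x idx ih =>
    have h1 := key idx
    have h2 := key (.read x idx)
    simp only [cost, cb, hb] at *; omega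
  | add a b iha ihb =>
    have h1 := key a; have h2 := key b; have h3 := key (.add a b)
    simp only [cost, cb, hb] at *; omega
  | sub a b iha ihb =>
    have h1 := key a; have h2 := key b; have h3 := key (.sub a b)
    simp only [cost, cb, hb] at *; omega
  | mul a b iha ihb =>
    have h1 := key a; have h2 := key b; have h3 := key (.mul a b)
    simp only [cost, cb, hb] at *; omega
  | div a b iha ihb =>
    have h1 := key a; have h2 := key b; have h3 := key (.div a b)
    simp only [cost, cb, hb] at *; omega

/-- Bound for the running time of a program, if all numbers in the memory have height at most `K`
throughout, and there are at most `L` items and at most `L` rounds in each run of a loop. -/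
def Program.time (K L : ℕ) : Program → ℕ
  | skip => 1
  | assign _ idx e => idx.cb K + e.cb K + 1
  | seq c d => c.time K L + d.time K L
  | ite a b c d => a.cb K + b.cb K + 1 + (c.time K L + d.time K L)
  | .while a b c => (L + 1) * (a.cb K + b.cb K + 1 + c.time K L)
  | demand i _ _ => i.cb K + 1 + 4 * (L * K)
  | xos i _ _ => i.cb K + 1 + 4 * (L * K)

theorem Expr.exists_hb_le (e : Expr) :
    ∃ p : Polynomial ℕ, ∀ K, e.hb (fun _ => K) ≤ p.eval K := by
  have op (a b : Expr) (ha : ∃ p : Polynomial ℕ, ∀ K, a.hb (fun _ => K) ≤ p.eval K)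
      (hb : ∃ p : Polynomial ℕ, ∀ K, b.hb (fun _ => K) ≤ p.eval K) :
      ∃ p : Polynomial ℕ, ∀ K, a.hb (fun _ => K) + b.hb (fun _ => K) + 1 ≤ p.eval K := by
    obtain ⟨p, hp⟩ := ha
    obtain ⟨q, hq⟩ := hb
    refine ⟨p + q + 1, fun K => ?_⟩
    simpa using add_le_add (hp K) (hq K)
  induction e with
  | const q => exact ⟨Polynomial.C (ht q), fun K => by simp [hb]⟩
  | read x idx => exact ⟨Polynomial.X, fun K => by simp [hb]⟩
  | add a b iha ihb => exact op a b iha ihb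
  | sub a b iha ihb => exact op a b iha ihb
  | mul a b iha ihb => exact op a b iha ihb
  | div a b iha ihb => exact op a b iha ihb

theorem Expr.exists_cb_le (e : Expr) : ∃ p : Polynomial ℕ, ∀ K, e.cb K ≤ p.eval K := by
  have op (a b : Expr) (ha : ∃ p : Polynomial ℕ, ∀ K, a.cb K ≤ p.eval K)
      (hb : ∃ p : Polynomial ℕ, ∀ K, b.cb K ≤ p.eval K) :
      ∃ p : Polynomial ℕ, ∀ K, a.cb K + b.cb K +
        (3 + 4 * a.hb (fun _ => K) + 4 * b.hb (fun _ => K)) ≤ p.eval K := by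
    obtain ⟨p, hp⟩ := ha
    obtain ⟨q, hq⟩ := hb
    obtain ⟨p', hp'⟩ := a.exists_hb_le
    obtain ⟨q', hq'⟩ := b.exists_hb_le
    refine ⟨p + q + (3 + 4 * p' + 4 * q'), fun K => ?_⟩
    have h1 := hp K; have h2 := hq K; have h3 := hp' K; have h4 := hq' K
    simp only [Polynomial.eval_add, Polynomial.eval_mul, Polynomial.eval_ofNat]
    omega
  induction e with
  | const q => exact ⟨Polynomial.C (1 + 2 * ht q), fun K => by simp [cb]⟩
  | read x idx ih =>
    obtain ⟨p, hp⟩ := ih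
    obtain ⟨p', hp'⟩ := idx.exists_hb_le
    refine ⟨p + (1 + 2 * p' + 2 * Polynomial.X), fun K => ?_⟩
    have h1 := hp K; have h3 := hp' K
    simp only [cb, Polynomial.eval_add, Polynomial.eval_mul, Polynomial.eval_ofNat,
      Polynomial.eval_X, Polynomial.eval_one]
    omega
  | add a b iha ihb => exact op a b iha ihb
  | sub a b iha ihb => exact op a b iha ihb
  | mul a b iha ihb => exact op a b iha ihb
  | div a b iha ihb => exact op a b iha ihb

theorem eval_mono (p : Polynomial ℕ) {a b : ℕ} (h : a ≤ b) : p.eval a ≤ p.eval b := by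
  rw [Polynomial.eval_eq_sum, Polynomial.eval_eq_sum]
  exact Finset.sum_le_sum fun i _ => Nat.mul_le_mul_left _ (Nat.pow_le_pow_left h i)

/-- The program is fixed, so the recursion over its text uses only sums and products of polynomials;
each level of loop nesting contributes one factor `L + 1`. -/
theorem Program.exists_time_le (c : Program) :
    ∃ p : Polynomial ℕ, ∀ K L, c.time K L ≤ p.eval (K + L) := by
  have lift (e : Expr) : ∃ p : Polynomial ℕ, ∀ K L, e.cb K ≤ p.eval (K + L) := by
    obtain ⟨p, hp⟩ := e.exists_cb_le
    exact ⟨p, fun K L => (hp K).trans (eval_mono p (Nat.le_add_right _ _))⟩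
  have query (e : Expr) : ∃ p : Polynomial ℕ, ∀ K L, e.cb K + 1 + 4 * (L * K) ≤ p.eval (K + L) := by
    obtain ⟨p, hp⟩ := lift e
    refine ⟨p + 1 + 4 * (Polynomial.X * Polynomial.X), fun K L => ?_⟩
    simp only [Polynomial.eval_add, Polynomial.eval_mul, Polynomial.eval_ofNat,
      Polynomial.eval_X, Polynomial.eval_one]
    gcongr
    · exact hp K L
    · omega
    · omega
  induction c with
  | skip => exact ⟨1, fun K L => by simp [time]⟩
  | assign x idx e =>
    obtain ⟨p, hp⟩ := lift idx
    obtain ⟨q, hq⟩ := lift e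
    refine ⟨p + q + 1, fun K L => ?_⟩
    simpa [time] using add_le_add (hp K L) (hq K L)
  | seq c d ihc ihd =>
    obtain ⟨p, hp⟩ := ihc
    obtain ⟨q, hq⟩ := ihd
    refine ⟨p + q, fun K L => ?_⟩
    simpa [time] using add_le_add (hp K L) (hq K L)
  | ite a b c d ihc ihd =>
    obtain ⟨p, hp⟩ := ihc
    obtain ⟨q, hq⟩ := ihd
    obtain ⟨p', hp'⟩ := lift a
    obtain ⟨q', hq'⟩ := lift b
    refine ⟨p' + q' + 1 + (p + q), fun K L => ?_⟩
    simp only [time, Polynomial.eval_add, Polynomial.eval_one]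
    gcongr <;> apply_assumption
  | demand e => exact query e
  | xos e => exact query e
  -- The remaining constructor is the loop.
  | _ a b c ih =>
    obtain ⟨p, hp⟩ := ih
    obtain ⟨p', hp'⟩ := lift a
    obtain ⟨q', hq'⟩ := lift b
    refine ⟨(Polynomial.X + 1) * (p' + q' + 1 + p), fun K L => ?_⟩
    simp only [time, Polynomial.eval_add, Polynomial.eval_one, Polynomial.eval_mul,
      Polynomial.eval_X]
    gcongr
    · omega
    all_goals apply_assumption

/-! ### Symbolic execution -/

theorem Memory.set_apply (σ : Memory) (x k : ℕ) (q : ℚ) (y l : ℕ) :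
    σ.set x k q y l = if y = x ∧ l = k then q else σ y l := rfl

theorem Memory.set_of_ne (σ : Memory) {x y : ℕ} (k : ℕ) (q : ℚ) (h : y ≠ x) :
    σ.set x k q y = σ y := by
  funext l; simp [Memory.set_apply, h]

theorem Memory.setVec_of_ne {m : ℕ} (σ : Memory) {x y : ℕ} (f : Fin m → ℚ) (h : y ≠ x) :
    σ.setVec x f y = σ y := by
  funext l; simp [Memory.setVec, h]

theorem Memory.setVec_self {m : ℕ} (σ : Memory) (x : ℕ) (f : Fin m → ℚ) (e : Fin m) :
    σ.setVec x f x e = f e := by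
  simp [Memory.setVec]

theorem Fits.set {κ : ℕ → ℕ} {σ : Memory} (h : Fits κ σ) {x k : ℕ} {q : ℚ} (hq : ht q ≤ κ x) :
    Fits κ (σ.set x k q) := by
  intro y l
  rw [Memory.set_apply]
  split_ifs with hy
  · exact hy.1 ▸ hq
  · exact h y l

theorem Fits.setVec {κ : ℕ → ℕ} {σ : Memory} (h : Fits κ σ) {m x : ℕ} {f : Fin m → ℚ}
    (hf : ∀ e, ht (f e) ≤ κ x) : Fits κ (σ.setVec x f) := by
  intro y l
  unfold Memory.setVec
  split_ifs with hy
  · obtain ⟨rfl, hl⟩ := hy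
    exact hf _
  · exact h y l

/-- Started in `σ`, program `c` halts within the time read off its text, in a memory that fits `κ`
and satisfies `Q`. -/
def Run {n m : ℕ} (O : Oracles n m) (κ : ℕ → ℕ) (K L : ℕ) (c : Program) (σ : Memory)
    (Q : Memory → Prop) : Prop :=
  ∃ t τ, Exec O c σ t τ ∧ t ≤ c.time K L ∧ Fits κ τ ∧ Q τ

section Rules

variable {n m : ℕ} {O : Oracles n m} {κ : ℕ → ℕ} {K L : ℕ} {σ : Memory} {Q Q' : Memory → Prop}

/-- Correctness needs separate height bounds for the arrays, whereas the time bound uses one common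
`K`. -/
theorem Fits.const (hκ : ∀ x, κ x ≤ K) (h : Fits κ σ) : Fits (fun _ => K) σ :=
  fun x k => (h x k).trans (hκ x)

theorem Run.mono {c : Program} (h : Run O κ K L c σ Q') (hQ : ∀ τ, Fits κ τ → Q' τ → Q τ) :
    Run O κ K L c σ Q := by
  obtain ⟨t, τ, h1, h2, h3, h4⟩ := h
  exact ⟨t, τ, h1, h2, h3, hQ τ h3 h4⟩

theorem Run.skip (hσ : Fits κ σ) (hQ : Q σ) : Run O κ K L .skip σ Q :=
  ⟨1, σ, .skip σ, le_rfl, hσ, hQ⟩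

theorem Run.assign (hκ : ∀ x, κ x ≤ K) (hσ : Fits κ σ) {x : ℕ} {idx e : Expr}
    (he : ht (e.eval σ) ≤ κ x) (hQ : Q (σ.set x ⌊idx.eval σ⌋₊ (e.eval σ))) :
    Run O κ K L (.assign x idx e) σ Q := by
  refine ⟨_, _, .assign x idx e σ, ?_, hσ.set he, hQ⟩
  have h1 := idx.cost_le (hσ.const hκ)
  have h2 := e.cost_le (hσ.const hκ)
  simp only [Program.time]; omega

theorem Run.seq {c d : Program} (hc : Run O κ K L c σ Q')
    (hd : ∀ τ, Fits κ τ → Q' τ → Run O κ K L d τ Q) : Run O κ K L (.seq c d) σ Q := by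
  obtain ⟨t, τ, h1, h2, h3, h4⟩ := hc
  obtain ⟨u, ρ, g1, g2, g3, g4⟩ := hd τ h3 h4
  exact ⟨t + u, ρ, .seq h1 g1, add_le_add h2 g2, g3, g4⟩

theorem Run.assign_seq (hκ : ∀ x, κ x ≤ K) (hσ : Fits κ σ) {x : ℕ} {idx e : Expr} {d : Program}
    (he : ht (e.eval σ) ≤ κ x)
    (hd : Fits κ (σ.set x ⌊idx.eval σ⌋₊ (e.eval σ)) →
      Run O κ K L d (σ.set x ⌊idx.eval σ⌋₊ (e.eval σ)) Q) :
    Run O κ K L (.seq (.assign x idx e) d) σ Q :=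
  Run.seq (Q' := fun τ => τ = σ.set x ⌊idx.eval σ⌋₊ (e.eval σ))
    (Run.assign hκ hσ he rfl) fun _ hτ h => by subst h; exact hd hτ

theorem Run.ite (hκ : ∀ x, κ x ≤ K) (hσ : Fits κ σ) {a b : Expr} {c d : Program}
    (hc : a.eval σ ≤ b.eval σ → Run O κ K L c σ Q)
    (hd : b.eval σ < a.eval σ → Run O κ K L d σ Q) : Run O κ K L (.ite a b c d) σ Q := by
  have h1 := a.cost_le (hσ.const hκ)
  have h2 := b.cost_le (hσ.const hκ)
  by_cases h : a.eval σ ≤ b.eval σ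
  · obtain ⟨t, τ, g1, g2, g3, g4⟩ := hc h
    exact ⟨_, τ, .ite_true h g1, by simp only [Program.time]; omega, g3, g4⟩
  · obtain ⟨t, τ, g1, g2, g3, g4⟩ := hd (not_le.1 h)
    exact ⟨_, τ, .ite_false h g1, by simp only [Program.time]; omega, g3, g4⟩

theorem vecSize_le {f : Fin m → ℚ} (hf : ∀ e, ht (f e) ≤ K) (hm : m ≤ L) :
    vecSize f ≤ 2 * (L * K) := by
  calc vecSize f ≤ ∑ _e : Fin m, 2 * K :=
        Finset.sum_le_sum fun e _ => (bitSize_le_ht _).trans (Nat.mul_le_mul_left _ (hf e))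
    _ = m * (2 * K) := by simp
    _ ≤ L * (2 * K) := Nat.mul_le_mul_right _ hm
    _ = 2 * (L * K) := by ring

theorem Run.demand (hκ : ∀ x, κ x ≤ K) (hσ : Fits κ σ) (hm : m ≤ L) {e : Expr} {p out : ℕ}
    (i : Fin n) (hi : e.eval σ = (i : ℕ)) (h1 : 1 ≤ κ out)
    (hQ : Q (σ.setVec out (O.demandVec i (σ.vec m p)))) :
    Run O κ K L (.demand e p out) σ Q := by
  have hf : ∀ j, ht (O.demandVec i (σ.vec m p) j) ≤ κ out := by
    intro j
    unfold Oracles.demandVec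
    split_ifs
    · rwa [ht_one]
    · rwa [ht_zero]
  refine ⟨_, _, .demand i (by simp [hi]), ?_, hσ.setVec hf, hQ⟩
  have g1 := e.cost_le (hσ.const hκ)
  have g2 : vecSize (σ.vec m p) ≤ 2 * (L * K) :=
    vecSize_le (fun j => hσ.const hκ p j) hm
  have g3 := vecSize_le (fun j => (hf j).trans (hκ out)) hm
  simp only [Program.time]; omega

theorem Run.xos (hκ : ∀ x, κ x ≤ K) (hσ : Fits κ σ) (hm : m ≤ L) {e : Expr} {s out : ℕ}
    (i : Fin n) (hi : e.eval σ = (i : ℕ)) (hf : ∀ j, ht (O.xosVec i (σ.vec m s) j) ≤ κ out)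
    (hQ : Q (σ.setVec out (O.xosVec i (σ.vec m s)))) :
    Run O κ K L (.xos e s out) σ Q := by
  refine ⟨_, _, .xos i (by simp [hi]), ?_, hσ.setVec hf, hQ⟩
  have g1 := e.cost_le (hσ.const hκ)
  have g2 : vecSize (σ.vec m s) ≤ 2 * (L * K) :=
    vecSize_le (fun j => hσ.const hκ s j) hm
  have g3 := vecSize_le (fun j => (hf j).trans (hκ out)) hm
  simp only [Program.time]; omega

/-- The scalar `x[0]`. -/
def Expr.rd (x : ℕ) : Expr := .read x (.const 0)

/-- The entry `x[v[0]]`. -/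
def Expr.at (x v : ℕ) : Expr := .read x (.rd v)

@[simp] theorem Expr.eval_rd (x : ℕ) : (Expr.rd x).eval σ = σ x 0 := by simp [rd, eval]

theorem Expr.eval_at {x v j : ℕ} (h : σ v 0 = j) : (Expr.at x v).eval σ = σ x j := by
  simp [Expr.at, eval, h]

/-- `x[0] := e`. -/
def Program.setS (x : ℕ) (e : Expr) : Program := .assign x (.const 0) e

theorem Run.setS_seq (hκ : ∀ x, κ x ≤ K) (hσ : Fits κ σ) {x : ℕ} {e : Expr} {d : Program} {q : ℚ}
    (he : e.eval σ = q) (hq : ht q ≤ κ x)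
    (hd : Fits κ (σ.set x 0 q) → Run O κ K L d (σ.set x 0 q) Q) :
    Run O κ K L (.seq (Program.setS x e) d) σ Q := by
  subst he
  refine Run.assign_seq hκ hσ hq fun hF => ?_
  simp only [Expr.eval, Nat.floor_zero] at hF ⊢
  exact hd hF

/-- `x[v[0]] := e`. -/
def Program.setA (x v : ℕ) (e : Expr) : Program := .assign x (.rd v) e

/-- `for v[0] = 0, …, b[0] - 1 do c`. -/
def Program.for (v b : ℕ) (c : Program) : Program :=
  .seq (.setS v (.const 0))
    (.while (.add (.rd v) (.const 1)) (.rd b) (.seq c (.setS v (.add (.rd v) (.const 1)))))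

/-- Induction on the number `r` of rounds that are left. The body must leave the counter at `j`, and
the invariant is required only after the counter has been advanced. The bound `k + 1 ≤ κ v` is what
the height of a counter of value at most `k` needs. -/
theorem Run.while_of_invariant (hκ : ∀ x, κ x ≤ K) {v b : ℕ} {c : Program} {k : ℕ}
    (hv : k + 1 ≤ κ v) (I : ℕ → Memory → Prop) (hb : ∀ j τ, I j τ → τ b 0 = k)
    (hstep : ∀ j < k, ∀ τ, Fits κ τ → τ v 0 = j → I j τ →
      Run O κ K L c τ fun ρ => ρ v 0 = j ∧ I (j + 1) (ρ.set v 0 (j + 1 : ℕ)))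
    (r : ℕ) : ∀ j τ, j + r = k → Fits κ τ → τ v 0 = j → I j τ →
      ∃ t ρ, Exec O (.while (.add (.rd v) (.const 1)) (.rd b)
        (.seq c (.setS v (.add (.rd v) (.const 1))))) τ t ρ ∧
        t ≤ (r + 1) * ((Expr.add (.rd v) (.const 1)).cb K + (Expr.rd b).cb K + 1 +
          (Program.seq c (.setS v (.add (.rd v) (.const 1)))).time K L) ∧
        Fits κ ρ ∧ I k ρ := by
  induction r with
  | zero =>
    intro j τ hj hτ hvj hI
    refine ⟨_, τ, .while_false ?_, ?_, hτ, by simpa [← hj] using hI⟩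
    · simp [Expr.eval, hvj, hb j τ hI, ← hj]
    · have h1 := (Expr.add (.rd v) (.const 1)).cost_le (hτ.const hκ)
      have h2 := (Expr.rd b).cost_le (hτ.const hκ)
      omega
  | succ r ih =>
    intro j τ hj hτ hvj hI
    have hjk : j < k := by omega
    have hbody : Run O κ K L (Program.seq c (.setS v (.add (.rd v) (.const 1)))) τ
        fun ρ => ρ v 0 = (j + 1 : ℕ) ∧ I (j + 1) ρ := by
      refine Run.seq (hstep j hjk τ hτ hvj hI) fun ρ hρ h => ?_
      have he : (Expr.add (.rd v) (.const 1)).eval ρ = ((j + 1 : ℕ) : ℚ) := by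
        simp [Expr.eval, h.1]
      refine Run.assign hκ hρ ?_ ?_
      · rw [he]
        exact (ht_natCast _).trans (by omega)
      · rw [he]
        simpa [Expr.eval, Memory.set_apply] using h.2
    obtain ⟨t, ρ, h1, h2, h3, h4, h5⟩ := hbody
    obtain ⟨t', ρ', g1, g2, g3, g4⟩ := ih (j + 1) ρ (by omega) h3 h4 h5
    refine ⟨_, ρ', .while_true ?_ h1 g1, ?_, g3, g4⟩
    · simp only [Expr.eval, Expr.eval_rd, hvj, hb j τ hI]
      exact_mod_cast hjk
    · have e1 := (Expr.add (.rd v) (.const 1)).cost_le (hτ.const hκ)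
      have e2 := (Expr.rd b).cost_le (hτ.const hκ)
      rw [Nat.succ_mul]
      omega

theorem Run.for (hκ : ∀ x, κ x ≤ K) (hσ : Fits κ σ) {v b : ℕ} {c : Program} {k : ℕ} (hk : k ≤ L)
    (hv : k + 1 ≤ κ v) (I : ℕ → Memory → Prop) (h0 : I 0 (σ.set v 0 0))
    (hb : ∀ j τ, I j τ → τ b 0 = k)
    (hstep : ∀ j < k, ∀ τ, Fits κ τ → τ v 0 = j → I j τ →
      Run O κ K L c τ fun ρ => ρ v 0 = j ∧ I (j + 1) (ρ.set v 0 (j + 1 : ℕ))) :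
    Run O κ K L (.for v b c) σ (I k) := by
  refine Run.assign_seq hκ hσ (by simp only [Expr.eval, ht_zero]; omega) fun hF => ?_
  simp only [Expr.eval, Nat.floor_zero] at hF ⊢
  obtain ⟨t, ρ, h1, h2, h3, h4⟩ := Run.while_of_invariant hκ hv I hb hstep k 0 _ (by omega) hF
    (by simp [Memory.set_apply]) h0
  refine ⟨t, ρ, h1, h2.trans ?_, h3, h4⟩
  simp only [Program.time]
  gcongr

end Rules

/-- Memories `σ` and `τ` agree outside the arrays in `X`. -/
def Same (X : List ℕ) (σ τ : Memory) : Prop := ∀ x ∉ X, τ x = σ x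

theorem Same.refl (X : List ℕ) (σ : Memory) : Same X σ σ := fun _ _ => rfl

theorem Same.set {X : List ℕ} {σ τ : Memory} (h : Same X σ τ) {x k : ℕ} {q : ℚ} (hx : x ∈ X) :
    Same X σ (τ.set x k q) := fun y hy => by
  rw [Memory.set_of_ne _ _ _ (by rintro rfl; exact hy hx), h y hy]

theorem Same.setVec {X : List ℕ} {σ τ : Memory} (h : Same X σ τ) {m x : ℕ} {f : Fin m → ℚ}
    (hx : x ∈ X) : Same X σ (τ.setVec x f) := fun y hy => by
  rw [Memory.setVec_of_ne _ _ (by rintro rfl; exact hy hx), h y hy]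

theorem Same.trans {X Y Z : List ℕ} {σ τ ρ : Memory} (h : Same X σ τ) (h' : Same Y τ ρ)
    (hX : X ⊆ Z) (hY : Y ⊆ Z) : Same Z σ ρ := fun y hy => by
  rw [h' y fun e => hy (hY e), h y fun e => hy (hX e)]

/-! ### Maxmin values and oracle answers -/

section Valuations

variable {n m : ℕ} {V : Finset (Fin m) → ℚ} {D : (Fin m → ℚ) → Finset (Fin m)}
  {X : Finset (Fin m) → Fin m → ℚ}

theorem mem_bundle {P : Fin m → Fin n} {j : Fin n} {e : Fin m} : e ∈ bundle P j ↔ P e = j := by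
  simp [bundle]

theorem IsXOSValuation.le_of_subset (hV : IsXOSValuation V) {S T : Finset (Fin m)} (h : S ⊆ T) :
    V S ≤ V T := by
  have := (le_max_left _ _).trans (hV.mono S T)
  rwa [Finset.union_eq_right.2 h] at this

theorem IsXOSOracle.le_singleton (hX : IsXOSOracle V X) {S : Finset (Fin m)} {e : Fin m}
    (he : e ∈ S) : X S e ≤ V {e} := by
  simpa using (hX S).2 {e} (by simpa using he)

/-- Subadditivity over single items follows from any oracle answer on `S`: its entries are dominated
by the single values. -/
theorem IsXOSOracle.le_sum_singleton (hX : IsXOSOracle V X) (S : Finset (Fin m)) :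
    V S ≤ ∑ e ∈ S, V {e} := by
  rw [← (hX S).1]
  exact Finset.sum_le_sum fun e he => hX.le_singleton he

theorem IsXOSOracle.singleton (hX : IsXOSOracle V X) (e : Fin m) : X {e} e = V {e} := by
  simpa using (hX {e}).1

/-- An item of a demanded set contributes at least its price. -/
theorem price_le_contribution (hD : IsDemandOracle V D) (hX : IsXOSOracle V X) (p : Fin m → ℚ)
    {e : Fin m} (he : e ∈ D p) : p e ≤ X (D p) e := by
  -- Compare the demanded set with itself minus `e`: the price saved is at most the value lost, and
  -- the rest is still worth at least its contributions.
  have h1 := hD p ((D p).erase e)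
  have h2 := (hX (D p)).2 _ (Finset.erase_subset e (D p))
  have h3 := (hX (D p)).1
  rw [← Finset.add_sum_erase _ _ he] at h3
  rw [← Finset.add_sum_erase (D p) p he] at h1
  linarith

variable [NeZero n]

theorem exists_partition_of_le_mms {x : ℚ} (h : x ≤ mms V n) :
    ∃ P : Fin m → Fin n, ∀ j, x ≤ V (bundle P j) := by
  obtain ⟨P, -, hP⟩ := Finset.exists_mem_eq_sup' Finset.univ_nonempty
    (fun P : Fin m → Fin n => Finset.univ.inf' Finset.univ_nonempty fun j => V (bundle P j))
  refine ⟨P, fun j => h.trans ?_⟩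
  unfold mms
  rw [hP]
  exact Finset.inf'_le _ (Finset.mem_univ j)

theorem le_mms {x : ℚ} (P : Fin m → Fin n) (h : ∀ j, x ≤ V (bundle P j)) : x ≤ mms V n := by
  unfold mms
  exact (Finset.le_inf' _ _ fun j _ => h j).trans
    (Finset.le_sup' (fun P : Fin m → Fin n =>
      Finset.univ.inf' Finset.univ_nonempty fun j => V (bundle P j)) (Finset.mem_univ P))

/-- The maxmin value is at least the `n`-th largest value of an item. -/
theorem le_mms_of_card_le (hV : IsXOSValuation V) {w : ℚ}
    (h : n ≤ (Finset.univ.filter fun e => w ≤ V {e}).card) : w ≤ mms V n := by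
  obtain ⟨t, ht, hc⟩ := Finset.exists_subset_card_eq h
  let φ := t.equivFinOfCardEq hc
  -- One of the `n` chosen items goes into each part. All other items go into part `0`, where by
  -- monotonicity they do no harm.
  refine le_mms (fun e => if he : e ∈ t then φ ⟨e, he⟩ else 0) fun j => ?_
  have hj := (φ.symm j).2
  have hw : w ≤ V {(φ.symm j : Fin m)} := (Finset.mem_filter.1 (ht hj)).2
  refine hw.trans (hV.le_of_subset ?_)
  rw [Finset.singleton_subset_iff, mem_bundle]
  simp

/-- The maxmin value is at most `m` times a number that fewer than `n` items exceed in value. -/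
theorem mms_le_of_card_lt (hX : IsXOSOracle V X) {w : ℚ} (hw : 0 ≤ w)
    (h : (Finset.univ.filter fun e => w < V {e}).card < n) : mms V n ≤ m * w := by
  obtain ⟨P, hP⟩ := exists_partition_of_le_mms (le_refl (mms V n))
  -- Pigeonhole: the fewer than `n` items of value above `w` miss some part.
  obtain ⟨j, hj⟩ : ∃ j, j ∉ (Finset.univ.filter fun e => w < V {e}).image P := by
    by_contra! hcon
    have h1 : (Finset.univ : Finset (Fin n)) ⊆
        (Finset.univ.filter fun e => w < V {e}).image P := fun j _ => hcon j
    have h2 := (Finset.card_le_card h1).trans Finset.card_image_le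
    rw [Finset.card_fin] at h2
    omega
  have hle : ∀ e ∈ bundle P j, V {e} ≤ w := fun e he => by
    by_contra! hlt
    exact hj (Finset.mem_image.2 ⟨e, by simpa using hlt, mem_bundle.1 he⟩)
  calc mms V n ≤ V (bundle P j) := hP j
    _ ≤ ∑ e ∈ bundle P j, V {e} := hX.le_sum_singleton _
    _ ≤ (bundle P j).card • w := Finset.sum_le_card_nsmul _ _ _ hle
    _ ≤ m * w := by
      rw [nsmul_eq_mul]
      gcongr
      simpa using Finset.card_le_univ (bundle P j)

end Valuations

/-! ### Local search -/

/-- A state of the local search: the owner of each item, the contribution of each item to the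
value of its owner, in units of that agent, and the unit of each agent. An item with contribution
one will stay with its owner. -/
structure State (n m : ℕ) where
  own : Fin m → Fin n
  C : Fin m → ℚ
  u : Fin n → ℚ

namespace State

variable {n m : ℕ}

/-- Total contribution of the items of agent `k`. -/
def load (st : State n m) (k : Fin n) : ℚ := ∑ e, if st.own e = k then st.C e else 0

/-- Agent `i` does not have one unit yet. -/
def Unsat (st : State n m) (i : Fin n) : Prop := st.u i * st.load i < st.u i

/-- The items that will stay with their owners. -/
def perm (st : State n m) : Finset (Fin m) := Finset.univ.filter fun e => st.C e = 1

/-- Agent `i` receives the items `e` with `d e > 0`, which contribute `d e`, and gives up the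
others. -/
def give (st : State n m) (i : Fin n) (d : Fin m → ℚ) : State n m where
  own e := if d e ≤ 0 then st.own e else i
  -- An item that is given up formally stays with `i` at contribution zero, so `own` is always an
  -- allocation of all items.
  C e := if d e ≤ 0 then if st.own e = i then 0 else st.C e else d e / st.u i
  u := st.u

/-- The unit of agent `i` is reduced, and the search starts again. -/
def reduce (st : State n m) (i : Fin n) : State n m where
  own := st.own
  C _ := 0
  u := Function.update st.u i (st.u i * (1 - 1 / (8 * n)))

/-- Agent `i` can be given the items `e` with `d e > 0`. -/
structure Gift (V : Fin n → Finset (Fin m) → ℚ) (st : State n m) (i : Fin n) (d : Fin m → ℚ) :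
    Prop where
  nonneg : ∀ e, 0 ≤ d e
  dom : ∀ T : Finset (Fin m), (∀ e ∈ T, 0 < d e) → ∑ e ∈ T, d e ≤ V i T
  free : ∀ e, 0 < d e → st.C e < 1
  -- Either one item counted as exactly one unit, which becomes permanent, or a trimmed demanded set
  -- of items below one unit; the last condition of the second case says that each item pays its
  -- price.
  large : (∃ e₀, d = fun e => if e = e₀ then st.u i else 0) ∨
    (∀ e, d e < st.u i) ∧ 2 * st.u i ≤ ∑ e, d e ∧ ∑ e, d e < 3 * st.u i ∧
      ∀ e, 0 < d e → (2 + 1 / n) * st.u i * st.C e ≤ d e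

variable {V : Fin n → Finset (Fin m) → ℚ} {st : State n m}

theorem sum_load (st : State n m) : ∑ k, st.load k = ∑ e, st.C e := by
  unfold load
  rw [Finset.sum_comm]
  simp

theorem C_le_load (hC : ∀ e, 0 ≤ st.C e) (e : Fin m) : st.C e ≤ st.load (st.own e) := by
  unfold load
  refine le_trans (by simp) (Finset.single_le_sum (f := fun e' =>
    if st.own e' = st.own e then st.C e' else 0) (fun e' _ => ?_) (Finset.mem_univ e))
  split_ifs
  · exact hC e'
  · exact le_rfl

theorem load_give_self {i : Fin n} {d : Fin m → ℚ} (hd : ∀ e, 0 ≤ d e) :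
    (st.give i d).load i = (∑ e, d e) / st.u i := by
  unfold load give
  rw [Finset.sum_div]
  refine Finset.sum_congr rfl fun e _ => ?_
  by_cases h : d e ≤ 0
  · have h0 : d e = 0 := le_antisymm h (hd e)
    by_cases ho : st.own e = i <;> simp [h0, ho]
  · simp [h]

theorem load_give_le (hC : ∀ e, 0 ≤ st.C e) {i k : Fin n} {d : Fin m → ℚ} (hk : k ≠ i) :
    (st.give i d).load k ≤ st.load k := by
  unfold load give
  refine Finset.sum_le_sum fun e _ => ?_
  by_cases h : d e ≤ 0
  · by_cases ho : st.own e = k <;> simp [h, ho, hk]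
  · have := hC e
    simp only [h, if_false, hk.symm]
    split_ifs <;> simp_all

theorem Gift.le_u {i : Fin n} {d : Fin m → ℚ} (hd : Gift V st i d) (hu : 0 < st.u i) (e : Fin m) : d e ≤ st.u i := by
  rcases hd.large with ⟨e₀, rfl⟩ | ⟨h, -⟩
  · dsimp only
    split_ifs
    · exact le_rfl
    · exact hu.le
  · exact (h e).le

variable [NeZero n]

/-- One round of the local search. -/
def Step (V : Fin n → Finset (Fin m) → ℚ) (st st' : State n m) : Prop :=
  ∃ i, st.Unsat i ∧ ((∃ d, st.Gift V i d ∧ st' = st.give i d) ∨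
    (mms (V i) n < (8 - 1 / n) * st.u i ∧ st' = st.reduce i))

/-- The invariant of the local search, where the unit of agent `k` has been reduced `f k` times. -/
structure Inv (V : Fin n → Finset (Fin m) → ℚ) (w : Fin n → ℚ) (f : Fin n → ℕ) (st : State n m) :
    Prop where
  C_nonneg : ∀ e, 0 ≤ st.C e
  C_le : ∀ e, st.C e ≤ 1
  dom : ∀ k, ∀ T : Finset (Fin m), (∀ e ∈ T, st.own e = k) → st.u k * ∑ e ∈ T, st.C e ≤ V k T
  load_lt : ∀ k, st.load k < 3
  load_perm : ∀ e, st.C e = 1 → st.load (st.own e) = 1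
  mms_le : ∀ k, mms (V k) n ≤ 8 * st.u k
  u_eq : ∀ k, st.u k = m * w k * (1 - 1 / (8 * n)) ^ f k
  f_le : ∀ k, f k ≤ 64 * n * m

/-- The potential of the local search. -/
def potential (st : State n m) (f : Fin n → ℕ) : ℚ :=
  -- The weights are lexicographic: the contributions sum to at most `3n` and there are at most `n`
  -- permanent items. So `4n` exceeds the possible loss in the last term, and `4n² + 4n` the
  -- possible loss in the last two.
  (4 * n ^ 2 + 4 * n) * ∑ k, (f k : ℚ) + 4 * n * st.perm.card + ∑ e, st.C e

variable {w : Fin n → ℚ} {f : Fin n → ℕ} {st' : State n m}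

theorem one_le_cast : (1 : ℚ) ≤ n := by exact_mod_cast NeZero.one_le

theorem factor_pos : (0 : ℚ) < 1 - 1 / (8 * n) := by
  have := one_le_cast (n := n)
  rw [sub_pos, div_lt_one (by linarith)]
  linarith

/-! ### Consequences of the invariant and the central estimate -/

namespace Inv

theorem u_nonneg (h : Inv V w f st) (hw : ∀ k, 0 ≤ w k) (k : Fin n) : 0 ≤ st.u k := by
  rw [h.u_eq]
  exact mul_nonneg (mul_nonneg (Nat.cast_nonneg _) (hw k)) (pow_nonneg factor_pos.le _)

/-- `Unsat` compares `u * load` with `u` precisely so that an agent with unit zero counts as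
satisfied; divisions by the unit of an unsatisfied agent are then legitimate. -/
theorem u_pos (h : Inv V w f st) (hw : ∀ k, 0 ≤ w k) {i : Fin n} (hi : st.Unsat i) :
    0 < st.u i := by
  refine lt_of_le_of_ne (h.u_nonneg hw i) fun h0 => ?_
  unfold Unsat at hi
  rw [← h0] at hi
  simp at hi

theorem load_lt_one (h : Inv V w f st) (hw : ∀ k, 0 ≤ w k) {i : Fin n} (hi : st.Unsat i) :
    st.load i < 1 := by
  have := h.u_pos hw hi
  unfold Unsat at hi
  by_contra! hl
  nlinarith

/-- Two permanent items of one agent would give load at least 2, but the owner of a permanent item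
has load exactly 1. -/
theorem own_injOn (h : Inv V w f st) : Set.InjOn st.own st.perm := by
  intro e he e' he' heq
  simp only [perm, Finset.coe_filter, Finset.mem_univ, true_and, Set.mem_ofPred_eq] at he he'
  by_contra hne
  have h1 := h.load_perm e he
  have h2 : st.C e + st.C e' ≤ st.load (st.own e) := by
    unfold load
    rw [← Finset.sum_filter, ← Finset.sum_pair hne]
    refine Finset.sum_le_sum_of_subset_of_nonneg ?_ fun e _ _ => h.C_nonneg e
    intro x hx
    rcases Finset.mem_insert.1 hx with rfl | hx
    · simp
    · simp [Finset.mem_singleton.1 hx, heq]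
  linarith

theorem card_perm_le (h : Inv V w f st) : st.perm.card ≤ n := by
  rw [← Finset.card_image_of_injOn h.own_injOn]
  simpa using Finset.card_le_univ (st.perm.image st.own)

theorem sum_C_le (h : Inv V w f st) : ∑ e, st.C e ≤ 3 * n := by
  rw [← sum_load]
  refine (Finset.sum_le_sum fun k _ => (h.load_lt k).le).trans ?_
  simp [mul_comm]

theorem sum_C_nonneg (h : Inv V w f st) : 0 ≤ ∑ e, st.C e :=
  Finset.sum_nonneg fun e _ => h.C_nonneg e

theorem potential_lt (h : Inv V w f st) : (2 * n + 1) * st.potential f < 1600 * (n + m : ℚ) ^ 6 := by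
  have hn := one_le_cast (n := n)
  have h1 : ∑ k, (f k : ℚ) ≤ n * (64 * n * m) := by
    refine (Finset.sum_le_card_nsmul _ _ (64 * n * m : ℚ) fun k _ => by
      exact_mod_cast h.f_le k).trans ?_
    simp
  have h2 : (st.perm.card : ℚ) ≤ n := by exact_mod_cast h.card_perm_le
  have h3 := h.sum_C_le
  have hm : (0 : ℚ) ≤ m := Nat.cast_nonneg m
  obtain ⟨z, hz⟩ : ∃ z : ℚ, z = n + m := ⟨_, rfl⟩
  have hz1 : (1 : ℚ) ≤ z := by linarith
  have hnz : (n : ℚ) ≤ z := by linarith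
  have hmz : (m : ℚ) ≤ z := by linarith
  have hpot : st.potential f ≤ (4 * z ^ 2 + 4 * z) * (z * (64 * z * z)) + 4 * z * z + 3 * z := by
    unfold potential
    have a1 : ∑ k, (f k : ℚ) ≤ z * (64 * z * z) := h1.trans (by gcongr)
    have a2 : (st.perm.card : ℚ) ≤ z := h2.trans hnz
    have a3 : ∑ e, st.C e ≤ 3 * z := h3.trans (by linarith)
    gcongr
  have h0 : (0 : ℚ) ≤ 2 * n + 1 := by linarith
  rw [← hz]
  calc (2 * n + 1) * st.potential f
      ≤ (2 * n + 1) * ((4 * z ^ 2 + 4 * z) * (z * (64 * z * z)) + 4 * z * z + 3 * z) :=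
        mul_le_mul_of_nonneg_left hpot h0
    _ ≤ (3 * z) * ((4 * z ^ 2 + 4 * z) * (z * (64 * z * z)) + 4 * z * z + 3 * z) := by
        gcongr
        linarith
    -- The left side expands to `768 z⁶ + 768 z⁵ + 12 z³ + 9 z²`, which is at most `1557 z⁶` since
    -- `z ≥ 1`.
    _ < 1600 * z ^ 6 := by
        have b1 : z ^ 5 ≤ z ^ 6 := pow_le_pow_right₀ hz1 (by norm_num)
        have b2 : z ^ 3 ≤ z ^ 6 := pow_le_pow_right₀ hz1 (by norm_num)
        have b3 : z ^ 2 ≤ z ^ 6 := pow_le_pow_right₀ hz1 (by norm_num)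
        have b4 : 0 < z ^ 6 := by positivity
        nlinarith

/-- If the guess for the maxmin value of an unsatisfied agent is right, the agent demands a set of
value at least two units. -/
theorem two_mul_le_demand (h : Inv V w f st) (hw : ∀ k, 0 ≤ w k) {i : Fin n}
    {D : (Fin m → ℚ) → Finset (Fin m)} (hD : IsDemandOracle (V i) D)
    (hV : IsXOSValuation (V i)) (hi : st.Unsat i)
    (hmms : (8 - 1 / n) * st.u i ≤ mms (V i) n) {p : Fin m → ℚ}
    (hp : ∀ e, p e = if 1 ≤ st.C e then V i {e} + 1 else (2 + 1 / n) * st.u i * st.C e) :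
    2 * st.u i ≤ V i (D p) := by
  have hn := one_le_cast (n := n)
  have hu := h.u_pos hw hi
  obtain ⟨P, hP⟩ := exists_partition_of_le_mms hmms
  -- `A` consists of the owners of permanent items, `J` of the parts of `P` without permanent items.
  -- Injectivity of ownership makes `A` as large as the set of permanent items, whence `J` is at
  -- least as large as the complement of `A`.
  set A := st.perm.image st.own with hA
  set J := Finset.univ \ st.perm.image P with hJ
  have hAcard : A.card = st.perm.card := Finset.card_image_of_injOn h.own_injOn
  have hload : ∀ k ∈ A, st.load k = 1 := fun k hk => by
    obtain ⟨e, he, rfl⟩ := Finset.mem_image.1 hk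
    exact h.load_perm e (Finset.mem_filter.1 he).2
  have hiA : i ∉ A := fun hiA => by
    have := h.load_lt_one hw hi
    rw [hload i hiA] at this
    exact lt_irrefl _ this
  have hAlt : A.card + (Finset.univ \ A).card = n := by
    rw [add_comm, Finset.card_sdiff_add_card_eq_card (Finset.subset_univ A), Finset.card_fin]
  have hJge : (Finset.univ \ A).card ≤ J.card := by
    have h1 : J.card + (st.perm.image P).card = n := by
      rw [Finset.card_sdiff_add_card_eq_card (Finset.subset_univ _), Finset.card_fin]
    have h2 : (st.perm.image P).card ≤ st.perm.card := Finset.card_image_le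
    omega
  have hpos : 0 < (Finset.univ \ A).card := Finset.card_pos.2 ⟨i, by simp [hiA]⟩
  have hJne : J.Nonempty := Finset.card_pos.1 (hpos.trans_le hJge)
  -- The saving of 2 comes from agent `i`, who lies outside `A` and has load below 1 rather than 3.
  have hother : ∑ k ∈ Finset.univ \ A, st.load k ≤ 3 * ((Finset.univ \ A).card : ℚ) - 2 := by
    calc ∑ k ∈ Finset.univ \ A, st.load k
        ≤ ∑ k ∈ Finset.univ \ A, (3 - if k = i then 2 else 0 : ℚ) := by
          refine Finset.sum_le_sum fun k _ => ?_
          split_ifs with hk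
          · subst hk
            linarith [h.load_lt_one hw hi]
          · linarith [h.load_lt k]
      _ = _ := by
          rw [Finset.sum_sub_distrib]
          simp [hiA, mul_comm]
  have htotal : ∑ e, st.C e = st.perm.card + ∑ k ∈ Finset.univ \ A, st.load k := by
    rw [← sum_load, ← Finset.sum_sdiff (Finset.subset_univ A), add_comm, Finset.sum_congr rfl hload]
    simp [hAcard]
  have hfree : ∑ e, (if st.C e = 1 then 0 else st.C e) = ∑ k ∈ Finset.univ \ A, st.load k := by
    have h1 : ∑ e, (if st.C e = 1 then (1 : ℚ) else 0) = st.perm.card := by simp [perm]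
    have h2 : ∑ e, (if st.C e = 1 then 0 else st.C e) +
        ∑ e, (if st.C e = 1 then (1 : ℚ) else 0) = ∑ e, st.C e := by
      rw [← Finset.sum_add_distrib]
      refine Finset.sum_congr rfl fun e _ => ?_
      split_ifs with hc <;> simp [hc]
    linarith
  have hJsum : ∑ j ∈ J, ∑ e ∈ bundle P j, st.C e ≤ ∑ e, (if st.C e = 1 then 0 else st.C e) := by
    calc ∑ j ∈ J, ∑ e ∈ bundle P j, st.C e
        = ∑ j ∈ J, ∑ e, (if P e = j then st.C e else 0) :=
          Finset.sum_congr rfl fun j _ => Finset.sum_filter _ _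
      _ = ∑ e, (if P e ∈ J then st.C e else 0) := by
          rw [Finset.sum_comm]
          simp
      _ ≤ _ := by
          refine Finset.sum_le_sum fun e _ => ?_
          by_cases hc : st.C e = 1
          · have : P e ∉ J := by
              simp only [hJ, Finset.mem_sdiff, Finset.mem_univ, true_and, not_not]
              exact Finset.mem_image_of_mem P (by simpa [perm] using hc)
            simp [this, hc]
          · rw [if_neg hc]
            split_ifs
            · exact le_rfl
            · exact h.C_nonneg e
  -- Averaging over `J`: the saving of 2 is shared by at most `n` agents, and `3 - 2/n ≥ 0` permits
  -- enlarging the count to `J.card`.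
  obtain ⟨j, hjJ, hj⟩ : ∃ j ∈ J, ∑ e ∈ bundle P j, st.C e ≤ 3 - 2 / n := by
    refine Finset.exists_le_of_sum_le hJne (hJsum.trans (hfree.le.trans (hother.trans ?_)))
    rw [Finset.sum_const, nsmul_eq_mul]
    have h1 : ((Finset.univ \ A).card : ℚ) ≤ J.card := by exact_mod_cast hJge
    have h2 : ((Finset.univ \ A).card : ℚ) ≤ n := by
      have : (Finset.univ \ A).card ≤ n := by omega
      exact_mod_cast this
    have h3 : (0 : ℚ) ≤ 3 - 2 / n := by
      rw [sub_nonneg, div_le_iff₀ (by linarith)]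
      linarith
    have h4 : ((Finset.univ \ A).card : ℚ) * (2 / n) ≤ 2 := by
      rw [mul_div_assoc', div_le_iff₀ (by linarith)]
      linarith
    nlinarith [mul_le_mul_of_nonneg_right h1 h3]
  have hpj : ∑ e ∈ bundle P j, p e = (2 + 1 / n) * st.u i * ∑ e ∈ bundle P j, st.C e := by
    rw [Finset.mul_sum]
    refine Finset.sum_congr rfl fun e he => ?_
    rw [hp, if_neg]
    intro h1
    have hc : st.C e = 1 := le_antisymm (h.C_le e) h1
    refine (Finset.mem_sdiff.1 hjJ).2 (Finset.mem_image.2 ⟨e, ?_, mem_bundle.1 he⟩)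
    simpa [perm] using hc
  have hp0 : 0 ≤ ∑ e ∈ D p, p e := Finset.sum_nonneg fun e _ => by
    rw [hp]
    have := h.C_nonneg e
    have := hV.nonneg {e}
    split_ifs <;> positivity
  have hopt := hD p (bundle P j)
  have hval := hP j
  -- The coefficient `2 + 1/n` is chosen so that the terms `1/n` cancel against the threshold `8 -
  -- 1/n` and exactly 2 units of surplus remain. Prices are nonnegative, so the value of the
  -- demanded set is at least its surplus.
  have hprice : ∑ e ∈ bundle P j, p e ≤ (6 - 1 / n) * st.u i := by
    rw [hpj]
    calc (2 + 1 / n) * st.u i * ∑ e ∈ bundle P j, st.C e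
        ≤ (2 + 1 / n) * st.u i * (3 - 2 / n) := by gcongr
      _ = (6 - 1 / n - 2 / n ^ 2) * st.u i := by
          field_simp
          ring
      _ ≤ (6 - 1 / n) * st.u i := by
          refine mul_le_mul_of_nonneg_right ?_ hu.le
          have : (0 : ℚ) ≤ 2 / n ^ 2 := by positivity
          linarith
  nlinarith

end Inv

/-! ### Effect of a gift on invariant and potential -/

namespace Gift

variable {i : Fin n} {d : Fin m → ℚ}

theorem inv_give (hd : Gift V st i d) (h : Inv V w f st) (hw : ∀ k, 0 ≤ w k)
    (hV : IsXOSValuation (V i)) (hi : st.Unsat i) : Inv V w f (st.give i d) := by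
  have hu := h.u_pos hw hi
  have hl := h.load_lt_one hw hi
  have hC0 : ∀ e, 0 ≤ (st.give i d).C e := fun e => by
    have := hd.nonneg e
    have := h.C_nonneg e
    simp only [give]
    split_ifs <;> positivity
  refine ⟨hC0, fun e => ?_, fun k T hT => ?_, fun k => ?_, fun e he => ?_, h.mms_le, h.u_eq, h.f_le⟩
  · simp only [give]
    split_ifs
    · exact zero_le_one
    · exact h.C_le e
    · rw [div_le_one hu]
      exact hd.le_u hu e
  · by_cases hk : k = i
    · subst hk
      calc st.u k * ∑ e ∈ T, (st.give k d).C e = ∑ e ∈ T.filter fun e => 0 < d e, d e := by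
            rw [Finset.sum_filter, Finset.mul_sum]
            refine Finset.sum_congr rfl fun e he => ?_
            have ho := hT e he
            by_cases hde : d e ≤ 0
            · simp only [give, hde, if_true] at ho ⊢
              simp [ho, not_lt.2 hde]
            · simp only [give, hde, if_false, not_le.1 hde, if_true]
              field_simp
        _ ≤ V k (T.filter fun e => 0 < d e) := hd.dom _ fun e he => (Finset.mem_filter.1 he).2
        _ ≤ V k T := hV.le_of_subset (Finset.filter_subset _ _)
    · have hnd : ∀ e ∈ T, d e ≤ 0 ∧ st.own e = k := fun e he => by
        have ho := hT e he
        by_cases hde : d e ≤ 0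
        · exact ⟨hde, by simpa [give, hde] using ho⟩
        · exact absurd (by simpa [give, hde] using ho.symm) hk
      refine le_trans (le_of_eq ?_) (h.dom k T fun e he => (hnd e he).2)
      congr 1
      refine Finset.sum_congr rfl fun e he => ?_
      simp [give, hnd e he, hk]
  · by_cases hk : k = i
    · subst hk
      rw [load_give_self hd.nonneg, div_lt_iff₀ hu]
      rcases hd.large with ⟨e₀, rfl⟩ | ⟨-, -, h3, -⟩
      · simp only [Finset.sum_ite_eq', Finset.mem_univ, if_true]
        linarith
      · exact h3
    · exact (load_give_le h.C_nonneg hk).trans_lt (h.load_lt k)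
  · by_cases hde : d e ≤ 0
    · simp only [give, hde, if_true] at he ⊢
      split_ifs at he with ho
      · exact absurd he zero_ne_one
      -- The load of another agent cannot grow, and the permanent item alone still accounts for load
      -- 1.
      · refine le_antisymm ((load_give_le h.C_nonneg ho).trans_eq (h.load_perm e he)) ?_
        have := C_le_load hC0 e
        simpa [give, hde, ho, he] using this
    · rcases hd.large with ⟨e₀, rfl⟩ | ⟨h1, -⟩
      · have : (st.give i fun e => if e = e₀ then st.u i else 0).own e = i := by
          simp only [give, hde, if_false]
        rw [this, load_give_self hd.nonneg]
        simp [hu.ne']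
      -- A trimmed gift creates no permanent item, since all its entries are below the unit.
      · simp only [give, hde, if_false] at he
        rw [div_eq_one_iff_eq hu.ne'] at he
        exact absurd he (h1 e).ne

/-- Permanent items are excluded from gifts, and the recipient has none to give up, because the load
of the recipient is below 1. -/
theorem perm_subset (hd : Gift V st i d) (h : Inv V w f st) (hw : ∀ k, 0 ≤ w k)
    (hi : st.Unsat i) : st.perm ⊆ (st.give i d).perm := by
  intro e he
  simp only [perm, Finset.mem_filter, Finset.mem_univ, true_and] at he ⊢
  have hde : d e ≤ 0 := by
    by_contra! hde
    exact (hd.free e hde).ne he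
  have ho : st.own e ≠ i := fun ho => by
    have := h.load_perm e he
    rw [ho] at this
    exact (h.load_lt_one hw hi).ne this
  simp [give, hde, ho, he]

/-- A single item gains `4n` for the new permanent item and loses at most `3n` in contributions. A
trimmed gift gains in contributions alone. -/
theorem potential_give (hd : Gift V st i d) (h : Inv V w f st) (hw : ∀ k, 0 ≤ w k)
    (h' : Inv V w f (st.give i d)) (hi : st.Unsat i) :
    st.potential f + 1 / (2 * n + 1) ≤ (st.give i d).potential f := by
  have hn := one_le_cast (n := n)
  have hu := h.u_pos hw hi
  have hl := h.load_lt_one hw hi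
  have hsub := hd.perm_subset h hw hi
  have hfrac : (1 : ℚ) / (2 * n + 1) ≤ 1 := by
    rw [div_le_one (by linarith)]
    linarith
  unfold potential
  rcases hd.large with ⟨e₀, he₀⟩ | ⟨-, h2, -, h4⟩
  · have hd0 : 0 < d e₀ := by simpa [he₀] using hu
    have hcard : (st.perm.card : ℚ) + 1 ≤ (st.give i d).perm.card := by
      have hss : st.perm ⊂ (st.give i d).perm := by
        refine Finset.ssubset_iff_subset_ne.2 ⟨hsub, fun heq => ?_⟩
        have h1 : e₀ ∈ (st.give i d).perm := by
          have hC : (st.give i d).C e₀ = d e₀ / st.u i := if_neg (not_le.2 hd0)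
          simp only [perm, Finset.mem_filter, Finset.mem_univ, true_and]
          rw [hC]
          simp [he₀, hu.ne']
        rw [← heq] at h1
        exact (hd.free e₀ hd0).ne (Finset.mem_filter.1 h1).2
      exact_mod_cast Finset.card_lt_card hss
    have a1 := h.sum_C_le
    have a2 := h'.sum_C_nonneg
    nlinarith
  · have hcard : (st.perm.card : ℚ) ≤ (st.give i d).perm.card := by
      exact_mod_cast Finset.card_le_card hsub
    -- Itemwise accounting. As `n / (2n+1)` is the inverse of `2 + 1/n`, the price condition says
    -- that the displaced contribution is at most this fraction of the new one. Items taken from `i`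
    -- itself are charged twice, which only weakens the bound.
    have hpt : ∀ e, st.C e - (if st.own e = i then st.C e else 0) +
        (1 - n / (2 * n + 1)) * (d e / st.u i) ≤ (st.give i d).C e := by
      intro e
      have hc0 := h.C_nonneg e
      by_cases hde : d e ≤ 0
      · have h0 : d e = 0 := le_antisymm hde (hd.nonneg e)
        by_cases ho : st.own e = i <;> simp [give, ho, h0]
      · simp only [give, hde, if_false]
        have h5 := h4 e (not_le.1 hde)
        have h6 : st.C e ≤ n / (2 * n + 1) * (d e / st.u i) := by
          rw [div_mul_div_comm, le_div_iff₀ (by positivity)]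
          calc st.C e * ((2 * n + 1) * st.u i) = n * ((2 + 1 / n) * st.u i * st.C e) := by
                field_simp
            _ ≤ n * d e := by gcongr
        have h7 : (0 : ℚ) ≤ if st.own e = i then st.C e else 0 := by split_ifs <;> simp [hc0]
        linarith
    have hsum := Finset.sum_le_sum fun e (_ : e ∈ Finset.univ) => hpt e
    rw [Finset.sum_add_distrib, Finset.sum_sub_distrib, ← Finset.mul_sum, ← Finset.sum_div] at hsum
    have hD : 2 ≤ (∑ e, d e) / st.u i := by rwa [le_div_iff₀ hu]
    -- The 1 pays for the previous load of `i`, which is below 1; the rest is the net gain.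
    have hcoef : (1 - n / (2 * n + 1) : ℚ) * 2 = 1 + 1 / (2 * n + 1) := by
      field_simp
      ring
    have hcoef0 : (0 : ℚ) ≤ 1 - n / (2 * n + 1) := by
      have : (0 : ℚ) ≤ 1 / (2 * n + 1) := by positivity
      linarith
    have hgain := mul_le_mul_of_nonneg_left hD hcoef0
    have hlo : ∑ e, (if st.own e = i then st.C e else 0) = st.load i := rfl
    have : 4 * n * (st.perm.card : ℚ) ≤ 4 * n * (st.give i d).perm.card := by gcongr
    linarith

end Gift

/-- With `x = 1/(8n)`: `(1 - x)^k * (1 + x)^k ≤ 1`, and `(1 + x)^k ≥ 1 + k x` by Bernoulli. This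
decay, only of order `1/k`, suffices to bound the number of reductions. -/
theorem pow_mul_le (k : ℕ) : (1 - 1 / (8 * n) : ℚ) ^ k * (8 * n + k) ≤ 8 * n := by
  have hn := one_le_cast (n := n)
  have h1 : (1 : ℚ) + k * (1 / (8 * n)) ≤ (1 + 1 / (8 * n)) ^ k :=
    one_add_mul_le_pow (by
      have : (0 : ℚ) ≤ 1 / (8 * n) := by positivity
      linarith) k
  have h2 : (1 - 1 / (8 * n) : ℚ) ^ k * (1 + 1 / (8 * n)) ^ k ≤ 1 := by
    rw [← mul_pow]
    refine pow_le_one₀ (mul_nonneg factor_pos.le (by positivity)) ?_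
    have : (0 : ℚ) ≤ (1 / (8 * n)) ^ 2 := by positivity
    linarith
  have h3 : (1 - 1 / (8 * n) : ℚ) ^ k * (1 + k * (1 / (8 * n))) ≤ 1 :=
    (mul_le_mul_of_nonneg_left h1 (pow_nonneg factor_pos.le k)).trans h2
  calc (1 - 1 / (8 * n) : ℚ) ^ k * (8 * n + k)
      = (1 - 1 / (8 * n) : ℚ) ^ k * (1 + k * (1 / (8 * n))) * (8 * n) := by field_simp
    _ ≤ 1 * (8 * n) := by gcongr
    _ = 8 * n := one_mul _

/-- Eight times the new unit is exactly `(8 - 1/n)` times the old one, so the hypothesis is what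
keeps the upper bound on `mms`. Forgetting all contributions makes the other conditions trivial,
apart from the count of reductions. -/
theorem Inv.reduce (h : Inv V w f st) (hw : ∀ k, 0 ≤ w k) (hwm : ∀ k, w k ≤ mms (V k) n)
    (hV : ∀ k, IsXOSValuation (V k)) {i : Fin n} (hi : mms (V i) n < (8 - 1 / n) * st.u i) :
    Inv V w (Function.update f i (f i + 1)) (st.reduce i) := by
  have hn := one_le_cast (n := n)
  refine ⟨fun _ => le_rfl, fun _ => zero_le_one, fun k T _ => ?_, fun k => ?_, fun e he => ?_,
    fun k => ?_, fun k => ?_, fun k => ?_⟩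
  · simpa [State.reduce] using (hV k).nonneg T
  · simp [load, State.reduce]
  · simp [State.reduce] at he
  · by_cases hk : k = i
    · subst hk
      simp only [State.reduce, Function.update_self]
      refine hi.le.trans (le_of_eq ?_)
      field_simp
    · simpa [State.reduce, hk] using h.mms_le k
  · by_cases hk : k = i
    · subst hk
      simp only [State.reduce, Function.update_self, pow_succ]
      rw [h.u_eq]
      ring
    · simpa [State.reduce, hk] using h.u_eq k
  · by_cases hk : k = i
    · subst hk
      rw [Function.update_self]
      have hu := h.u_nonneg hw k
      -- The maxmin value lies between `w k` and eight times the old unit; cancelling `w k` bounds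
      -- the decay factor from below.
      have h1 : w k < 8 * (m * w k * (1 - 1 / (8 * n)) ^ f k) := by
        rw [← h.u_eq]
        refine (hwm k).trans_lt (hi.trans_le ?_)
        gcongr
        have : (0 : ℚ) ≤ 1 / n := by positivity
        linarith
      have hw0 : 0 < w k := by
        refine lt_of_le_of_ne (hw k) fun h0 => ?_
        rw [← h0] at h1
        simp at h1
      have h2 : 1 < 8 * m * (1 - 1 / (8 * n) : ℚ) ^ f k := by
        by_contra! hc
        nlinarith
      have h3 := pow_mul_le (n := n) (f k)
      have h4 : (8 * n + f k : ℚ) < 8 * m * (8 * n) := by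
        calc (8 * n + f k : ℚ) < 8 * m * (1 - 1 / (8 * n) : ℚ) ^ f k * (8 * n + f k) :=
              lt_mul_of_one_lt_left (by positivity) h2
          _ = 8 * m * ((1 - 1 / (8 * n) : ℚ) ^ f k * (8 * n + f k)) := by ring
          _ ≤ 8 * m * (8 * n) := by gcongr
      -- The term `8 * n ≥ 1` leaves room for the additional reduction.
      have h5 : 8 * n + f k < 64 * n * m := by
        have : (8 * n + f k : ℚ) < 64 * n * m := by linarith
        exact_mod_cast this
      have : 1 ≤ n := NeZero.one_le
      omega
    · rw [Function.update_of_ne hk]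
      exact h.f_le k

/-- Each round keeps the invariant and raises the potential. -/
theorem Inv.step (h : Inv V w f st) (hw : ∀ k, 0 ≤ w k) (hwm : ∀ k, w k ≤ mms (V k) n)
    (hV : ∀ k, IsXOSValuation (V k)) (hs : Step V st st') :
    ∃ f', Inv V w f' st' ∧ st.potential f + 1 / (2 * n + 1) ≤ st'.potential f' := by
  obtain ⟨i, hi, ⟨d, hd, rfl⟩ | ⟨hm, rfl⟩⟩ := hs
  · have h' := hd.inv_give h hw (hV i) hi
    exact ⟨f, h', hd.potential_give h hw h' hi⟩
  · refine ⟨_, h.reduce hw hwm hV hm, ?_⟩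
    have hn := one_le_cast (n := n)
    have h1 := h.sum_C_le
    have h2 : (st.perm.card : ℚ) ≤ n := by exact_mod_cast h.card_perm_le
    have h3 : ∑ k, ((Function.update f i (f i + 1) k : ℕ) : ℚ) = ∑ k, (f k : ℚ) + 1 := by
      rw [← Finset.add_sum_erase _ _ (Finset.mem_univ i),
        ← Finset.add_sum_erase _ (fun k => (f k : ℚ)) (Finset.mem_univ i), Function.update_self,
        Finset.sum_congr rfl fun k hk => by rw [Function.update_of_ne (Finset.ne_of_mem_erase hk)]]
      push_cast
      ring
    have hfrac : (1 : ℚ) / (2 * n + 1) ≤ 1 := by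
      rw [div_le_one (by linarith)]
      linarith
    have h4 : (0 : ℚ) ≤ (st.reduce i).perm.card := Nat.cast_nonneg _
    have h5 : ∑ e, (st.reduce i).C e = 0 := by simp [State.reduce]
    unfold potential
    rw [h3, h5]
    -- The reduction gains `4n² + 4n` and loses at most `4n · n` for permanent items and `3n` for
    -- contributions.
    nlinarith

/-- If every agent has one unit, the allocation is good. -/
theorem Inv.isMMSAllocation (h : Inv V w f st) (hs : ∀ i, ¬ st.Unsat i) :
    IsMMSAllocation (1 / 8) V st.own := by
  intro i
  have h1 := h.dom i (bundle st.own i) fun e he => mem_bundle.1 he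
  have h2 : st.u i ≤ st.u i * st.load i := not_lt.1 (hs i)
  have h3 : ∑ e ∈ bundle st.own i, st.C e = st.load i := Finset.sum_filter _ _
  have h4 := h.mms_le i
  rw [h3] at h1
  linarith

/-- The item `e₀` alone is a gift. -/
theorem Inv.gift_singleton (h : Inv V w f st) (hw : ∀ k, 0 ≤ w k) {i : Fin n}
    (hV : IsXOSValuation (V i)) (hi : st.Unsat i) {e₀ : Fin m} (hC : st.C e₀ < 1) (he : st.u i ≤ V i {e₀}) :
    st.Gift V i fun e => if e = e₀ then st.u i else 0 := by
  have hu := h.u_pos hw hi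
  have hmem : ∀ e, 0 < (if e = e₀ then st.u i else 0) → e = e₀ := fun e h0 => by
    by_contra hne
    simp [hne] at h0
  refine ⟨fun e => by split_ifs <;> simp [hu.le], fun T hT => ?_, fun e h0 => hmem e h0 ▸ hC,
    .inl ⟨e₀, rfl⟩⟩
  rcases T.eq_empty_or_nonempty with rfl | ⟨x, hx⟩
  · simpa using hV.nonneg ∅
  · have : T = {e₀} := Finset.eq_singleton_iff_unique_mem.2
      ⟨hmem x (hT x hx) ▸ hx, fun e he => hmem e (hT e he)⟩
    simp [this, he]

/-- Part of a demanded set is a gift. -/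
theorem Inv.gift_demand (h : Inv V w f st) (hw : ∀ k, 0 ≤ w k) {i : Fin n}
    {D : (Fin m → ℚ) → Finset (Fin m)} {X : Finset (Fin m) → Fin m → ℚ}
    (hD : IsDemandOracle (V i) D) (hX : IsXOSOracle (V i) X)
    (hV : IsXOSValuation (V i)) (hi : st.Unsat i)
    {p : Fin m → ℚ}
    (hp : ∀ e, p e = if 1 ≤ st.C e then V i {e} + 1 else (2 + 1 / n) * st.u i * st.C e)
    (hsmall : ∀ e, st.C e < 1 → V i {e} < st.u i) {c : Fin m → ℚ}
    (hc : ∀ e, c e = if e ∈ D p then X (D p) e else 0) :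
    (∀ e, c e < st.u i) ∧ ∀ d : Fin m → ℚ, ((∀ e, d e = c e ∨ d e = 0) → 2 * st.u i ≤ ∑ e, d e →
      ∑ e, d e < 3 * st.u i → st.Gift V i d) := by
  have hu := h.u_pos hw hi
  have hp0 : ∀ e, 0 ≤ p e := fun e => by
    rw [hp]
    have := h.C_nonneg e
    have := hV.nonneg {e}
    split_ifs <;> positivity
  have hge : ∀ e ∈ D p, p e ≤ c e := fun e he => by
    rw [hc, if_pos he]
    exact price_le_contribution hD hX p he
  have hle : ∀ e ∈ D p, c e ≤ V i {e} := fun e he => by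
    rw [hc, if_pos he]
    exact hX.le_singleton he
  -- A permanent item costs `V i {e} + 1`, more than it can contribute, so it is never demanded.
  have hfree : ∀ e ∈ D p, st.C e < 1 := fun e he => by
    by_contra! h1
    have h2 := (hge e he).trans (hle e he)
    rw [hp, if_pos h1] at h2
    linarith
  have hclt : ∀ e, c e < st.u i := fun e => by
    by_cases he : e ∈ D p
    · exact (hle e he).trans_lt (hsmall e (hfree e he))
    · rwa [hc, if_neg he]
  have hc0 : ∀ e, 0 ≤ c e := fun e => by
    by_cases he : e ∈ D p
    · exact (hp0 e).trans (hge e he)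
    · rw [hc, if_neg he]
  refine ⟨hclt, fun d hd h2 h3 => ?_⟩
  have hmem : ∀ e, 0 < d e → e ∈ D p ∧ d e = c e := fun e he => by
    rcases hd e with h1 | h1
    · refine ⟨?_, h1⟩
      by_contra hn
      rw [h1, hc, if_neg hn] at he
      exact lt_irrefl _ he
    · exact absurd h1 he.ne'
  refine ⟨fun e => ?_, fun T hT => ?_, fun e he => hfree e (hmem e he).1,
    .inr ⟨fun e => ?_, h2, h3, fun e he => ?_⟩⟩
  · rcases hd e with h1 | h1 <;> rw [h1]
    exact hc0 e
  · rw [Finset.sum_congr rfl fun e he => (hmem e (hT e he)).2.trans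
      ((hc e).trans (if_pos (hmem e (hT e he)).1))]
    exact (hX (D p)).2 T fun e he => (hmem e (hT e he)).1
  · rcases hd e with h1 | h1 <;> rw [h1]
    · exact hclt e
    · exact hu
  · have h5 := hge e (hmem e he).1
    rwa [hp, if_neg (not_le.2 (hfree e (hmem e he).1)), ← (hmem e he).2] at h5

end State

/-! ### The program -/

section Text

open FairAllocation.Expr FairAllocation.Program

local infixr:60 " ;; " => Program.seq

/-- Stores in array `17` the loads of all agents, and in `19[0]` one plus the name of an agent who
is not satisfied, or zero if there is none. -/
def scanProg : Program :=
  .for 15 2 (setA 17 15 (const 0)) ;;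
  .for 15 1 (assign 17 (.at 0 15) (add (read 17 (.at 0 15)) (.at 5 15))) ;;
  setS 19 (const 0) ;;
  .for 15 2 (ite (.at 4 15) (mul (.at 4 15) (.at 17 15)) skip (setS 19 (add (rd 15) (const 1))))

/-- Stores in array `8` the values of the single items for agent `12[0]`. -/
def rowProg : Program :=
  .for 15 1 (setA 6 15 (const 1) ;; xos (rd 12) 6 7 ;; setA 8 15 (.at 7 15) ;; setA 6 15 (const 0))

/-- Looks for an item that satisfies agent `12[0]` alone. -/
def singleProg : Program :=
  setS 13 (const 0) ;;
  .for 15 1 (setA 7 15 (const 0) ;;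
    ite (const 1) (rd 13) skip (ite (const 1) (.at 5 15) skip
      (ite (.at 4 12) (.at 8 15) (setA 7 15 (.at 4 12) ;; setS 13 (const 1)) skip)))

/-- Computes the prices for agent `12[0]`. -/
def priceProg : Program :=
  .for 15 1 (ite (const 1) (.at 5 15) (setA 9 15 (add (.at 8 15) (const 1)))
    (setA 9 15 (mul (mul (add (const 2) (div (const 1) (rd 2))) (.at 4 12)) (.at 5 15))))

/-- Shrinks the contributions in array `7` until they sum up to less than three units. -/
def trimProg : Program :=
  setS 11 (const 0) ;;
  .for 15 1 (ite (mul (const 2) (.at 4 12)) (rd 11) (setA 7 15 (const 0))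
    (setS 11 (add (rd 11) (.at 7 15))))

/-- Looks for a gift for agent `12[0]` by a demand query. -/
def demandProg : Program :=
  priceProg ;; demand (rd 12) 9 10 ;; xos (rd 12) 10 7 ;; trimProg ;;
  ite (mul (const 2) (.at 4 12)) (rd 11) (setS 13 (const 1)) skip

/-- Gives agent `12[0]` the items with positive entries in array `7`. -/
def giveProg : Program :=
  .for 15 1 (ite (.at 7 15) (const 0)
    (ite (mul (sub (.at 0 15) (rd 12)) (sub (.at 0 15) (rd 12))) (const 0)
      (setA 5 15 (const 0)) skip)
    (setA 0 15 (rd 12) ;; setA 5 15 (div (.at 7 15) (.at 4 12))))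

/-- Reduces the unit of agent `12[0]` and restarts the search. -/
def reduceProg : Program :=
  setA 4 12 (mul (.at 4 12) (sub (const 1) (div (const 1) (mul (const 8) (rd 2))))) ;;
  .for 15 1 (setA 5 15 (const 0))

/-- One round of the local search. -/
def roundProg : Program :=
  scanProg ;;
  ite (const 1) (rd 19)
    (setS 12 (sub (rd 19) (const 1)) ;; rowProg ;; singleProg ;;
      ite (const 1) (rd 13) skip demandProg ;;
      ite (const 1) (rd 13) giveProg reduceProg)
    skip

/-- Stores in `11[0]` the `n`-th largest number in array `8`. -/
def rankProg : Program :=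
  setS 11 (const 0) ;;
  .for 15 1 (setS 18 (const 0) ;;
    .for 16 1 (ite (.at 8 15) (.at 8 16) (setS 18 (add (rd 18) (const 1))) skip) ;;
    ite (rd 2) (rd 18) (ite (rd 11) (.at 8 15) (setS 11 (.at 8 15)) skip) skip)

/-- Computes the constants. -/
def constProg : Program :=
  setS 2 (rd 0) ;; setS 0 (const 0) ;; setS 12 (add (rd 2) (rd 1)) ;;
  setS 3 (mul (const 1600) (mul (mul (mul (rd 12) (rd 12)) (mul (rd 12) (rd 12)))
    (mul (rd 12) (rd 12)))) ;; skip

/-- Computes the first units. -/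
def unitProg : Program := .for 12 2 (rowProg ;; rankProg ;; setA 4 12 (mul (rd 1) (rd 11)))

/-- The algorithm. -/
def mainProg : Program := constProg ;; unitProg ;; .for 14 3 roundProg

end Text

/-- Bound for the heights of the numbers in array `x`. -/
def cap (I U B S : ℕ) : ℕ → ℕ
  -- Array `4` holds units, `5` contributions in units, `7` oracle contributions and gifts, `8`
  -- single item values, `9` prices, `11` ranks and partial sums, `17` loads. The others hold
  -- natural numbers: owners, counters, flags and 0-1 vectors.
  | 4 => U
  | 5 => 2 * U + B + 4
  | 7 => U + B + 2
  | 8 => B + 1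
  | 9 => I + 3 * U + B + 12
  | 11 => S
  | 17 => S
  | _ => I

/-- The bounds are large enough. -/
structure Caps (n m B I U S K L : ℕ) : Prop where
  m_le : m ≤ L
  n_le : n ≤ L
  n_le_I : n + m + 2 ≤ I
  L_le : L + 2 ≤ I
  N_le : 1600 * (n + m) ^ 6 ≤ L
  U_le : m + B + 3 + (64 * n * m + 1) * (8 * n + 1) ≤ U
  S_le : m * (2 * U + B + 4 + 1) + B + 2 ≤ S
  cap_le : ∀ x, cap I U B S x ≤ K

/-- The memory holds the state of the local search. -/
structure Holds {n m : ℕ} (st : State n m) (σ : Memory) : Prop where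
  own : ∀ e : Fin m, σ 0 e = (st.own e : ℕ)
  C : ∀ e : Fin m, σ 5 e = st.C e
  u : ∀ k : Fin n, σ 4 k = st.u k
  items : σ 1 0 = m
  agents : σ 2 0 = n
  query : ∀ k, σ 6 k = 0

theorem Holds.of_same {n m : ℕ} {st : State n m} {σ τ : Memory} (h : Holds st σ) {X : List ℕ}
    (hs : Same X σ τ) (h0 : 0 ∉ X) (h1 : 1 ∉ X) (h2 : 2 ∉ X) (h4 : 4 ∉ X) (h5 : 5 ∉ X)
    (h6 : ∀ k, τ 6 k = 0) : Holds st τ :=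
  ⟨fun e => by rw [hs 0 h0, h.own], fun e => by rw [hs 5 h5, h.C], fun k => by rw [hs 4 h4, h.u],
    by rw [hs 1 h1, h.items], by rw [hs 2 h2, h.agents], h6⟩

theorem sum_ite_lt_succ {m : ℕ} (f : Fin m → ℚ) {j : ℕ} (hj : j < m) :
    (∑ e : Fin m, if (e : ℕ) < j + 1 then f e else 0) =
      (∑ e : Fin m, if (e : ℕ) < j then f e else 0) + f ⟨j, hj⟩ := by
  have h1 : f ⟨j, hj⟩ = ∑ e : Fin m, if e = ⟨j, hj⟩ then f e else 0 := by simp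
  rw [h1, ← Finset.sum_add_distrib]
  refine Finset.sum_congr rfl fun e _ => ?_
  simp only [Fin.ext_iff]
  rcases lt_trichotomy (e : ℕ) j with h | h | h
  · simp [h, h.ne, h.trans (Nat.lt_succ_self j)]
  · simp [h]
  · simp [h.ne', not_lt.2 h.le, not_lt.2 (Nat.succ_le_of_lt h)]

theorem sum_ite_lt_self {m : ℕ} (f : Fin m → ℚ) :
    (∑ e : Fin m, if (e : ℕ) < m then f e else 0) = ∑ e, f e := by simp

theorem ht_sum_ite_le {m : ℕ} {f : Fin m → ℚ} {K : ℕ} (hK : 1 ≤ K) (hf : ∀ e, ht (f e) ≤ K)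
    (p : Fin m → Prop) [DecidablePred p] : ht (∑ e, if p e then f e else 0) ≤ m * (K + 1) + 1 := by
  have := ht_sum Finset.univ (fun e => if p e then f e else 0) (K := K) fun e _ => by
    split_ifs
    · exact hf e
    · rwa [ht_zero]
  simpa using this

/-! ### Correctness and height bounds of the parts of the program -/

section Verification

variable {n m B I U S K L : ℕ} {O : Oracles n m} {σ : Memory}

/-- A loop that fills array `x`. -/
theorem Run.map {κ : ℕ → ℕ} (hκ : ∀ x, κ x ≤ K) (hσ : Fits κ σ) {v b x : ℕ} {c : Program} {k : ℕ}
    (hk : k ≤ L) (hv : k + 1 ≤ κ v) (hvx : v ≠ x) (hbv : b ∉ [v, x]) (hb : σ b 0 = k) (f : ℕ → ℚ)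
    (hc : ∀ j < k, ∀ τ, Fits κ τ → τ v 0 = j → Same [v, x] σ τ →
      Run O κ K L c τ fun ρ => ρ = τ.set x j (f j)) :
    Run O κ K L (.for v b c) σ fun τ => Same [v, x] σ τ ∧ ∀ j < k, τ x j = f j := by
  refine Run.for hκ hσ hk hv (fun j τ => Same [v, x] σ τ ∧ ∀ l < j, τ x l = f l)
    ⟨(Same.refl _ _).set (by simp), by simp⟩ (fun j τ h => by rw [h.1 b hbv, hb]) ?_
  intro j hj τ hτ hvj h
  refine (hc j hj τ hτ hvj h.1).mono fun ρ _ hρ => ?_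
  subst hρ
  refine ⟨by simp [Memory.set_apply, hvx, hvj],
    (h.1.set (by simp)).set (by simp), fun l hl => ?_⟩
  simp only [Memory.set_apply, hvx.symm, false_and, if_false, true_and]
  split_ifs with he
  · rw [he]
  · exact h.2 l (by omega)

variable {st : State n m}

theorem run_scan (h : Caps n m B I U S K L) (hσ : Fits (cap I U B S) σ) (hst : Holds st σ) :
    Run O (cap I U B S) K L scanProg σ fun τ => Same [15, 17, 19] σ τ ∧
      ((τ 19 0 = 0 ∧ ∀ k, ¬ st.Unsat k) ∨ ∃ i : Fin n, τ 19 0 = (i + 1 : ℕ) ∧ st.Unsat i) := by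
  have hnI := h.n_le_I
  have hSle := h.S_le
  have hIL := h.L_le
  refine Run.seq (Run.map h.cap_le hσ h.n_le (x := 17) (by simp only [cap]; omega)
    (by decide) (by decide) hst.agents (fun _ => 0) ?_) ?_
  · intro j hj τ hτ hv hs
    refine Run.assign h.cap_le hτ (by simp only [Expr.eval, ht_zero, cap]; omega) ?_
    simp [Expr.eval, hv]
  rintro τ hτ ⟨hs, hz⟩
  have hst1 := hst.of_same hs (by decide) (by decide) (by decide) (by decide) (by decide)
    fun k => by rw [hs 6 (by decide), hst.query]
  refine Run.seq (Run.for h.cap_le hτ h.m_le (by simp only [cap]; omega)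
    (fun j ρ => Same [15, 17] τ ρ ∧ ∀ k : Fin n,
      ρ 17 k = ∑ e : Fin m, if (e : ℕ) < j then if st.own e = k then st.C e else 0 else 0)
    ⟨(Same.refl _ _).set (by decide), fun k => ?_⟩ ?_ ?_) ?_
  · rw [Memory.set_of_ne _ _ _ (by decide), hz k k.2]
    simp
  · rintro j ρ ⟨hs, -⟩
    rw [hs 1 (by decide), hst1.items]
  · rintro j hj ρ hρ hv ⟨hs, hsum⟩
    have hi : (Expr.at 0 15).eval ρ = (st.own ⟨j, hj⟩ : ℕ) := by
      rw [Expr.eval_at hv, hs 0 (by decide), ← hst1.own]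
    have hval : (Expr.add (.read 17 (.at 0 15)) (.at 5 15)).eval ρ =
        ∑ e : Fin m, if (e : ℕ) < j + 1 then
          if st.own e = st.own ⟨j, hj⟩ then st.C e else 0 else 0 := by
      rw [sum_ite_lt_succ _ hj, ← hsum, if_pos rfl, ← hst1.C, ← hs 5 (by decide)]
      simp [Expr.eval, hi, Expr.eval_at hv]
    refine Run.assign h.cap_le hρ ?_ ?_
    · rw [hval]
      -- The accumulator is bounded as a partial sum of contributions; its own cap plus one addition
      -- would not stay within the cap.
      refine (ht_sum_ite_le (K := 2 * U + B + 4) (by omega) (fun e => ?_) _).trans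
        (by simp only [cap]; omega)
      split_ifs
      · rw [← hst1.C]
        exact hτ 5 e
      · rw [ht_zero]; omega
    · rw [hval, hi, Nat.floor_natCast]
      refine ⟨by simp [Memory.set_apply, hv], (hs.set (by decide)).set (by decide), fun k => ?_⟩
      rw [Memory.set_of_ne _ _ _ (by decide), Memory.set_apply]
      by_cases hk : k = st.own ⟨j, hj⟩
      · rw [if_pos ⟨rfl, by rw [hk]⟩, hk]
      · rw [if_neg fun hc => hk (Fin.ext hc.2), hsum, sum_ite_lt_succ _ hj,
          if_neg fun hc => hk hc.symm, add_zero]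
  rintro ρ hρ ⟨hs2, hsum⟩
  have hload : ∀ k : Fin n, ρ 17 k = st.load k := fun k => by
    rw [hsum, sum_ite_lt_self]
    rfl
  have hst2 := hst1.of_same hs2 (by decide) (by decide) (by decide) (by decide) (by decide)
    fun k => by rw [hs2 6 (by decide), hst1.query]
  refine Run.assign_seq h.cap_le hρ (by simp only [Expr.eval, ht_zero, cap]; omega) fun hF => ?_
  simp only [Expr.eval, Nat.floor_zero] at hF ⊢
  refine Run.mono (Run.for h.cap_le hF h.n_le (by simp only [cap]; omega)
    (fun j μ => Same [15, 19] ρ μ ∧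
      ((μ 19 0 = 0 ∧ ∀ k : Fin n, (k : ℕ) < j → ¬ st.Unsat k) ∨
        ∃ i : Fin n, μ 19 0 = (i + 1 : ℕ) ∧ st.Unsat i))
    ⟨((Same.refl _ _).set (by decide)).set (by decide),
      .inl ⟨by simp [Memory.set_apply], by simp⟩⟩ ?_ ?_) ?_
  · rintro j μ ⟨hs, -⟩
    rw [hs 2 (by decide), hst2.agents]
  · rintro j hj μ hμ hv ⟨hs, hor⟩
    have hu : (Expr.at 4 15).eval μ = st.u ⟨j, hj⟩ := by
      rw [Expr.eval_at hv, hs 4 (by decide), ← hst2.u]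
    have hl : (Expr.mul (.at 4 15) (.at 17 15)).eval μ = st.u ⟨j, hj⟩ * st.load ⟨j, hj⟩ := by
      rw [Expr.eval, hu, Expr.eval_at hv, hs 17 (by decide), ← hload]
    refine Run.ite h.cap_le hμ (fun hle => ?_) fun hlt => ?_
    · rw [hu, hl] at hle
      refine Run.skip hμ ⟨hv, hs.set (by decide), ?_⟩
      rw [Memory.set_of_ne _ _ _ (by decide)]
      refine hor.imp_left fun h1 => ⟨h1.1, fun k hk => ?_⟩
      rcases Nat.lt_succ_iff_lt_or_eq.1 hk with hk | hk
      · exact h1.2 k hk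
      · obtain rfl : k = ⟨j, hj⟩ := Fin.ext hk
        exact not_lt.2 hle
    · rw [hu, hl] at hlt
      have he : (Expr.add (.rd 15) (.const 1)).eval μ = (j + 1 : ℕ) := by simp [Expr.eval, hv]
      refine Run.assign h.cap_le hμ ?_ ⟨?_, (hs.set (by decide)).set (by decide),
        .inr ⟨⟨j, hj⟩, ?_, hlt⟩⟩
      · rw [he]
        exact (ht_natCast _).trans (by simp only [cap]; omega)
      · simp [Memory.set_apply, hv]
      · rw [Memory.set_of_ne _ _ _ (by decide), he]
        simp [Expr.eval, Memory.set_apply]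
  · rintro μ hμ ⟨hs3, hor⟩
    refine ⟨(hs.trans hs2 (Z := [15, 17]) (by decide) (by decide)).trans hs3
      (by decide) (by decide), hor.imp_left fun h1 => ⟨h1.1, fun k => h1.2 k k.2⟩⟩

/-- There is no value oracle: the value of an item is read off the XOS answer on its singleton.
Array `6` encodes that singleton, hence it must vanish between queries. -/
theorem run_row (h : Caps n m B I U S K L) {V : Fin n → Finset (Fin m) → ℚ}
    (hX : ∀ i, IsXOSOracle (V i) (O.xos i)) (hB : ∀ i S, ∀ j ∈ S, bitSize (O.xos i S j) ≤ B)
    (hσ : Fits (cap I U B S) σ) (hm : σ 1 0 = m) (hq : ∀ k, σ 6 k = 0) {i : Fin n}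
    (hi : σ 12 0 = (i : ℕ)) :
    Run O (cap I U B S) K L rowProg σ fun τ => Same [6, 7, 8, 15] σ τ ∧ (∀ k, τ 6 k = 0) ∧
      ∀ e : Fin m, τ 8 e = V i {e} := by
  have hnI := h.n_le_I
  have hIL := h.L_le
  refine Run.mono (Run.for h.cap_le hσ h.m_le (by simp only [cap]; omega)
    (fun j τ => Same [6, 7, 8, 15] σ τ ∧ (∀ k, τ 6 k = 0) ∧
      ∀ e : Fin m, (e : ℕ) < j → τ 8 e = V i {e})
    ⟨(Same.refl _ _).set (by decide), fun k => ?_, by simp⟩ ?_ ?_) ?_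
  · rw [Memory.set_of_ne _ _ _ (by decide), hq]
  · rintro j τ ⟨hs, -⟩
    rw [hs 1 (by decide), hm]
  · rintro j hj τ hτ hv ⟨hs, hq, hrow⟩
    refine Run.assign_seq h.cap_le hτ (by simp only [Expr.eval, ht_one, cap]; omega) fun hF => ?_
    simp only [Expr.eval, Expr.eval_rd, hv, Nat.floor_natCast] at hF ⊢
    have hvec : (Finset.univ.filter fun e => (τ.set 6 j 1).vec m 6 e ≠ 0) = {⟨j, hj⟩} := by
      ext e
      simp [Memory.vec, Memory.set_apply, hq, Fin.ext_iff]
    have hans : O.xosVec i ((τ.set 6 j 1).vec m 6) ⟨j, hj⟩ = V i {⟨j, hj⟩} := by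
      unfold Oracles.xosVec
      rw [hvec, (hX i).singleton, if_pos]
      simp [Memory.vec, Memory.set_apply]
    have hF2 : ht (V i {⟨j, hj⟩}) ≤ B := by
      rw [← (hX i).singleton]
      exact (ht_le_bitSize _).trans (hB i _ _ (by simp))
    refine Run.seq (Q' := fun ρ => ρ = (τ.set 6 j 1).setVec 7
      (O.xosVec i ((τ.set 6 j 1).vec m 6))) (Run.xos h.cap_le hF h.m_le i ?_ (fun e => ?_) rfl) ?_
    · rw [Expr.eval_rd, Memory.set_of_ne _ _ _ (by decide), hs 12 (by decide), hi]
    · unfold Oracles.xosVec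
      split_ifs with he
      · refine (ht_le_bitSize _).trans ((hB i _ e (by simpa using he)).trans ?_)
        simp only [cap]; omega
      · simp only [ht_zero, cap]; omega
    rintro ρ hρ rfl
    set ρ := (τ.set 6 j 1).setVec 7 (O.xosVec i ((τ.set 6 j 1).vec m 6)) with hρdef
    have hv1 : ρ 15 0 = j := by
      rw [hρdef, Memory.setVec_of_ne _ _ (by decide), Memory.set_of_ne _ _ _ (by decide), hv]
    have he : (Expr.at 7 15).eval ρ = V i {⟨j, hj⟩} := by
      rw [Expr.eval_at hv1, ← hans]
      exact Memory.setVec_self _ 7 _ ⟨j, hj⟩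
    refine Run.assign_seq h.cap_le hρ (by rw [he]; simp only [cap]; omega) fun hF3 => ?_
    simp only [Expr.eval_rd, he, hv1, Nat.floor_natCast] at hF3 ⊢
    have hs1 : Same [6, 7, 8, 15] σ (ρ.set 8 j (V i {⟨j, hj⟩})) :=
      ((hs.set (by decide)).setVec (by decide)).set (by decide)
    have hv2 : (ρ.set 8 j (V i {⟨j, hj⟩})) 15 0 = j := by
      rw [Memory.set_of_ne _ _ _ (by decide), hv1]
    refine Run.assign h.cap_le hF3 (by simp only [Expr.eval, ht_zero, cap]; omega) ?_
    simp only [Expr.eval, Expr.eval_rd, hv2, Nat.floor_natCast]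
    refine ⟨by rw [Memory.set_of_ne _ _ _ (by decide), hv2],
      (hs1.set (by decide)).set (by decide), fun k => ?_, fun e he => ?_⟩
    · rw [Memory.set_of_ne _ _ _ (by decide), Memory.set_apply]
      split_ifs with hk
      · rfl
      · rw [Memory.set_of_ne _ _ _ (by decide), hρdef, Memory.setVec_of_ne _ _ (by decide),
          Memory.set_apply, if_neg hk, hq]
    · rw [Memory.set_of_ne _ _ _ (by decide), Memory.set_of_ne _ _ _ (by decide), Memory.set_apply]
      split_ifs with hk
      · obtain rfl : e = ⟨j, hj⟩ := Fin.ext hk.2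
        rfl
      · rw [hρdef, Memory.setVec_of_ne _ _ (by decide), Memory.set_of_ne _ _ _ (by decide)]
        exact hrow e (by omega)
  · rintro τ hτ ⟨hs, hq, hrow⟩
    exact ⟨hs, hq, fun e => hrow e e.2⟩

theorem Caps.B_le (h : Caps n m B I U S K L) : m + B + 3 ≤ U :=
  (Nat.le_add_right _ _).trans h.U_le

theorem run_single (h : Caps n m B I U S K L) (hσ : Fits (cap I U B S) σ) (hst : Holds st σ)
    {i : Fin n} (hi : σ 12 0 = (i : ℕ)) {v : Fin m → ℚ} (hrow : ∀ e : Fin m, σ 8 e = v e) :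
    Run O (cap I U B S) K L singleProg σ fun τ => Same [7, 13, 15] σ τ ∧
      ((τ 13 0 = 0 ∧ ∀ e, st.C e < 1 → v e < st.u i) ∨
        (τ 13 0 = 1 ∧ ∃ e₀, st.C e₀ < 1 ∧ st.u i ≤ v e₀ ∧
          ∀ e : Fin m, τ 7 e = if e = e₀ then st.u i else 0)) := by
  have hnI := h.n_le_I
  have hIL := h.L_le
  have hUB := h.B_le
  refine Run.assign_seq h.cap_le hσ (by simp only [Expr.eval, ht_zero, cap]; omega) fun hF => ?_
  simp only [Expr.eval, Nat.floor_zero] at hF ⊢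
  refine Run.mono (Run.for h.cap_le hF h.m_le (by simp only [cap]; omega)
    (fun j τ => Same [7, 13, 15] σ τ ∧
      ((τ 13 0 = 0 ∧ ∀ e : Fin m, (e : ℕ) < j → τ 7 e = 0 ∧ (st.C e < 1 → v e < st.u i)) ∨
        (τ 13 0 = 1 ∧ ∃ e₀ : Fin m, (e₀ : ℕ) < j ∧ st.C e₀ < 1 ∧ st.u i ≤ v e₀ ∧
          ∀ e : Fin m, (e : ℕ) < j → τ 7 e = if e = e₀ then st.u i else 0)))
    ⟨((Same.refl _ _).set (by decide)).set (by decide),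
      .inl ⟨by simp [Memory.set_apply], by simp⟩⟩ ?_ ?_) ?_
  · rintro j τ ⟨hs, -⟩
    rw [hs 1 (by decide), hst.items]
  · rintro j hj τ hτ hv ⟨hs, hor⟩
    refine Run.assign_seq h.cap_le hτ (by simp only [Expr.eval, ht_zero, cap]; omega) fun hF => ?_
    simp only [Expr.eval, Expr.eval_rd, hv, Nat.floor_natCast] at hF ⊢
    have hs' : Same [7, 13, 15] σ (τ.set 7 j 0) := hs.set (by decide)
    have hv' : (τ.set 7 j 0) 15 0 = j := by rw [Memory.set_of_ne _ _ _ (by decide), hv]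
    have h13 : (τ.set 7 j 0) 13 0 = τ 13 0 := by rw [Memory.set_of_ne _ _ _ (by decide)]
    have hC : (Expr.at 5 15).eval (τ.set 7 j 0) = st.C ⟨j, hj⟩ := by
      rw [Expr.eval_at hv', hs' 5 (by decide), ← hst.C]
    have hr : (Expr.at 8 15).eval (τ.set 7 j 0) = v ⟨j, hj⟩ := by
      rw [Expr.eval_at hv', hs' 8 (by decide), ← hrow]
    have hu : (Expr.at 4 12).eval (τ.set 7 j 0) = st.u i := by
      rw [Expr.eval_at (by rw [hs' 12 (by decide), hi]), hs' 4 (by decide), ← hst.u]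
    -- Common continuation of the two ways in which an item is rejected: it is permanent, or it is
    -- worth less than the unit.
    have hnew : τ 13 0 = 0 → (∀ e : Fin m, (e : ℕ) < j → τ 7 e = 0 ∧ (st.C e < 1 → v e < st.u i)) →
        (st.C ⟨j, hj⟩ < 1 → v ⟨j, hj⟩ < st.u i) →
        Run O (cap I U B S) K L .skip (τ.set 7 j 0) fun ρ => ρ 15 0 = j ∧
          (Same [7, 13, 15] σ (ρ.set 15 0 (j + 1 : ℕ)) ∧
          (((ρ.set 15 0 (j + 1 : ℕ)) 13 0 = 0 ∧
            ∀ e : Fin m, (e : ℕ) < j + 1 →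
              (ρ.set 15 0 (j + 1 : ℕ)) 7 e = 0 ∧ (st.C e < 1 → v e < st.u i)) ∨
          ((ρ.set 15 0 (j + 1 : ℕ)) 13 0 = 1 ∧
            ∃ e₀ : Fin m, (e₀ : ℕ) < j + 1 ∧ st.C e₀ < 1 ∧ st.u i ≤ v e₀ ∧
            ∀ e : Fin m, (e : ℕ) < j + 1 →
              (ρ.set 15 0 (j + 1 : ℕ)) 7 e = if e = e₀ then st.u i else 0))) := by
      intro h0 hold hjn
      refine Run.skip hF ⟨hv', hs'.set (by decide), .inl ⟨?_, fun e he => ?_⟩⟩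
      · rw [Memory.set_of_ne _ _ _ (by decide), h13, h0]
      · rcases Nat.lt_succ_iff_lt_or_eq.1 he with he | he
        · refine ⟨?_, (hold e he).2⟩
          rw [Memory.set_of_ne _ _ _ (by decide), Memory.set_apply, if_neg fun hc => he.ne hc.2]
          exact (hold e he).1
        · obtain rfl : e = ⟨j, hj⟩ := Fin.ext he
          exact ⟨by simp [Memory.set_apply], hjn⟩
    refine Run.ite h.cap_le hF (fun hle => ?_) fun hlt => ?_
    · rw [Expr.eval, Expr.eval_rd, h13] at hle
      rcases hor with ⟨h0, -⟩ | ⟨h1, e₀, he₀, hC₀, hu₀, hall⟩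
      · rw [h0] at hle
        norm_num at hle
      · refine Run.skip hF ⟨hv', hs'.set (by decide),
          .inr ⟨?_, e₀, by omega, hC₀, hu₀, fun e he => ?_⟩⟩
        · rw [Memory.set_of_ne _ _ _ (by decide), h13, h1]
        · rw [Memory.set_of_ne _ _ _ (by decide), Memory.set_apply]
          split_ifs with c1 c2 c2
          · rw [c2] at c1
            omega
          · rfl
          · rw [hall e (by omega), if_pos c2]
          · rw [hall e (by omega), if_neg c2]
    · rw [Expr.eval, Expr.eval_rd, h13] at hlt
      rcases hor with ⟨h0, hold⟩ | ⟨h1, -⟩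
      swap
      · rw [h1] at hlt
        exact absurd hlt (lt_irrefl _)
      refine Run.ite h.cap_le hF (fun hle => ?_) fun hlt1 => ?_
      · rw [Expr.eval, hC] at hle
        exact hnew h0 hold fun hc => absurd hc (not_lt.2 hle)
      rw [Expr.eval, hC] at hlt1
      refine Run.ite h.cap_le hF (fun hle => ?_) fun hlt2 => ?_
      swap
      · rw [hu, hr] at hlt2
        exact hnew h0 hold fun _ => hlt2
      rw [hu, hr] at hle
      have hub : ht (st.u i) ≤ U := by
        rw [← hst.u]
        exact hσ 4 i
      refine Run.assign_seq h.cap_le hF (by rw [hu]; simp only [cap]; omega) fun hF2 => ?_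
      simp only [Expr.eval_rd, hv', Nat.floor_natCast, hu] at hF2 ⊢
      refine Run.assign h.cap_le hF2 (by simp only [Expr.eval, ht_one, cap]; omega) ?_
      simp only [Expr.eval, Nat.floor_zero]
      refine ⟨?_, ((hs'.set (by decide)).set (by decide)).set (by decide),
        .inr ⟨?_, ⟨j, hj⟩, Nat.lt_succ_self j, hlt1, hle, fun e he => ?_⟩⟩
      · rw [Memory.set_of_ne _ _ _ (by decide), Memory.set_of_ne _ _ _ (by decide), hv']
      · rw [Memory.set_of_ne _ _ _ (by decide)]
        simp [Memory.set_apply]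
      · rw [Memory.set_of_ne _ _ _ (by decide), Memory.set_of_ne _ _ _ (by decide),
          Memory.set_apply]
        by_cases c : e = ⟨j, hj⟩
        · simp [c]
        · have hne : (e : ℕ) ≠ j := fun hc => c (Fin.ext hc)
          simp [Memory.set_apply, c, hne, (hold e (by omega)).1]
  · rintro τ hτ ⟨hs, hor⟩
    refine ⟨hs, hor.imp (fun h1 => ⟨h1.1, fun e => (h1.2 e e.2).2⟩) ?_⟩
    rintro ⟨h1, e₀, -, hC₀, hu₀, hall⟩
    exact ⟨h1, e₀, hC₀, hu₀, fun e => hall e e.2⟩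

theorem run_price (h : Caps n m B I U S K L) (hσ : Fits (cap I U B S) σ) (hst : Holds st σ)
    {i : Fin n} (hi : σ 12 0 = (i : ℕ)) {v : Fin m → ℚ} (hrow : ∀ e : Fin m, σ 8 e = v e) :
    Run O (cap I U B S) K L priceProg σ fun τ => Same [15, 9] σ τ ∧ ∀ e : Fin m,
      τ 9 e = if 1 ≤ st.C e then v e + 1 else (2 + 1 / n) * st.u i * st.C e := by
  have hnI := h.n_le_I
  refine Run.mono (Run.map h.cap_le hσ h.m_le (x := 9) (by simp only [cap]; omega)
    (by decide) (by decide) hst.items (fun j => if hj : j < m then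
      if 1 ≤ st.C ⟨j, hj⟩ then v ⟨j, hj⟩ + 1 else (2 + 1 / n) * st.u i * st.C ⟨j, hj⟩ else 0) ?_)
    fun τ hτ hh => ⟨hh.1, fun e => by rw [hh.2 e e.2, dif_pos e.2]⟩
  intro j hj τ hτ hv hs
  have hC : (Expr.at 5 15).eval τ = st.C ⟨j, hj⟩ := by
    rw [Expr.eval_at hv, hs 5 (by decide), ← hst.C]
  have hr : (Expr.at 8 15).eval τ = v ⟨j, hj⟩ := by
    rw [Expr.eval_at hv, hs 8 (by decide), ← hrow]
  have hu : (Expr.at 4 12).eval τ = st.u i := by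
    rw [Expr.eval_at (by rw [hs 12 (by decide), hi]), hs 4 (by decide), ← hst.u]
  rw [dif_pos hj]
  have h2 : ht 2 ≤ 3 := ht_ofNat 2
  refine Run.ite h.cap_le hτ (fun hle => ?_) fun hlt => ?_
  · rw [Expr.eval, hC] at hle
    refine Run.assign h.cap_le hτ ((Expr.ht_eval_le hτ _).trans ?_) ?_
    · simp only [Expr.hb, Expr.at, ht_one, cap]
      omega
    · rw [if_pos hle, Expr.eval, hr, Expr.eval_rd, hv, Nat.floor_natCast, Expr.eval]
  · rw [Expr.eval, hC] at hlt
    refine Run.assign h.cap_le hτ ((Expr.ht_eval_le hτ _).trans ?_) ?_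
    · simp only [Expr.hb, Expr.at, Expr.rd, ht_one, cap]
      omega
    · rw [if_neg (not_le.2 hlt), Expr.eval_rd, hv, Nat.floor_natCast]
      simp only [Expr.eval, hC, hu, Expr.eval_rd, hs 2 (by decide), hst.agents]

/-- Items are kept until the total reaches two units. The last one adds less than one unit, so the
total stays below three; if two units are never reached, nothing has been discarded. -/
theorem run_trim (h : Caps n m B I U S K L) (hσ : Fits (cap I U B S) σ) (hst : Holds st σ)
    {i : Fin n} (hi : σ 12 0 = (i : ℕ)) {c : Fin m → ℚ} (hc : ∀ e : Fin m, σ 7 e = c e)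
    (hcu : ∀ e, c e < st.u i) (hu0 : 0 < st.u i) :
    Run O (cap I U B S) K L trimProg σ fun τ => Same [7, 11, 15] σ τ ∧
      ∃ d : Fin m → ℚ, (∀ e : Fin m, τ 7 e = d e) ∧ (∀ e, d e = c e ∨ d e = 0) ∧
        τ 11 0 = ∑ e, d e ∧ ∑ e, d e < 3 * st.u i ∧ (∑ e, d e < 2 * st.u i → d = c) := by
  have hnI := h.n_le_I
  have hIL := h.L_le
  have hUB := h.B_le
  have hSle := h.S_le
  have hcb : ∀ e, ht (c e) ≤ U + B + 2 := fun e => by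
    rw [← hc]
    exact hσ 7 e
  refine Run.assign_seq h.cap_le hσ (by simp only [Expr.eval, ht_zero, cap]; omega) fun hF => ?_
  simp only [Expr.eval, Nat.floor_zero] at hF ⊢
  refine Run.mono (Run.for h.cap_le hF h.m_le (by simp only [cap]; omega)
    (fun j τ => Same [7, 11, 15] σ τ ∧
      ∃ d : Fin m → ℚ, (∀ e : Fin m, τ 7 e = d e) ∧ (∀ e, d e = c e ∨ d e = 0) ∧
        (∀ e : Fin m, j ≤ e → d e = c e) ∧
        τ 11 0 = (∑ e : Fin m, if (e : ℕ) < j then d e else 0) ∧ τ 11 0 < 3 * st.u i ∧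
        (τ 11 0 < 2 * st.u i → d = c))
    ⟨((Same.refl _ _).set (by decide)).set (by decide), c, fun e => ?_, fun e => .inl rfl,
      fun e _ => rfl, ?_⟩ ?_ ?_) ?_
  · rw [Memory.set_of_ne _ _ _ (by decide), Memory.set_of_ne _ _ _ (by decide), hc]
  · simp [Memory.set_apply, hu0]
  · rintro j τ ⟨hs, -⟩
    rw [hs 1 (by decide), hst.items]
  · rintro j hj τ hτ hv ⟨hs, d, hd7, hdc, hdj, hacc, h3, h2⟩
    have hu : (Expr.at 4 12).eval τ = st.u i := by
      rw [Expr.eval_at (by rw [hs 12 (by decide), hi]), hs 4 (by decide), ← hst.u]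
    refine Run.ite h.cap_le hτ (fun hle => ?_) fun hlt => ?_
    · simp only [Expr.eval, hu, Expr.eval_rd] at hle
      refine Run.assign h.cap_le hτ (by simp only [Expr.eval, ht_zero, cap]; omega) ?_
      simp only [Expr.eval_rd, hv, Nat.floor_natCast, Expr.eval]
      have e11 : ((τ.set 7 j 0).set 15 0 (j + 1 : ℕ)) 11 0 = τ 11 0 := by
        rw [Memory.set_of_ne _ _ _ (by decide), Memory.set_of_ne _ _ _ (by decide)]
      refine ⟨by rw [Memory.set_of_ne _ _ _ (by decide), hv],
        (hs.set (by decide)).set (by decide), Function.update d ⟨j, hj⟩ 0, fun e => ?_,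
        fun e => ?_, fun e he => ?_, ?_, by rwa [e11], fun hlt => ?_⟩
      · rw [Memory.set_of_ne _ _ _ (by decide), Memory.set_apply, Function.update_apply, hd7]
        simp [Fin.ext_iff]
      · rw [Function.update_apply]
        split_ifs
        · exact .inr rfl
        · exact hdc e
      · rw [Function.update_of_ne (by rintro rfl; simp at he), hdj e (by omega)]
      · rw [e11, hacc, sum_ite_lt_succ _ hj, Function.update_self, add_zero]
        refine Finset.sum_congr rfl fun e _ => ?_
        split_ifs with he
        · rw [Function.update_of_ne (by rintro rfl; simp at he)]
        · rfl
      · rw [e11] at hlt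
        exact absurd hle (not_le.2 hlt)
    · simp only [Expr.eval, hu, Expr.eval_rd] at hlt
      have hval : (Expr.add (.rd 11) (.at 7 15)).eval τ =
          ∑ e : Fin m, if (e : ℕ) < j + 1 then d e else 0 := by
        rw [sum_ite_lt_succ _ hj, ← hacc, ← hd7]
        simp [Expr.eval, Expr.eval_at hv]
      have hdc' := h2 hlt
      refine Run.assign h.cap_le hτ ?_ ?_
      · rw [hval]
        refine (ht_sum_ite_le (K := 2 * U + B + 4) (by omega) (fun e => ?_) _).trans
          (by simp only [cap]; omega)
        rw [hdc']
        exact (hcb e).trans (by omega)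
      · simp only [Expr.eval, Nat.floor_zero]
        simp only [Expr.eval] at hval
        rw [hval]
        have e11 : ((τ.set 11 0 (∑ e : Fin m, if (e : ℕ) < j + 1 then d e else 0)).set 15 0
            (j + 1 : ℕ)) 11 0 = ∑ e : Fin m, if (e : ℕ) < j + 1 then d e else 0 := by
          rw [Memory.set_of_ne _ _ _ (by decide)]
          simp [Memory.set_apply]
        refine ⟨by rw [Memory.set_of_ne _ _ _ (by decide), hv],
          (hs.set (by decide)).set (by decide), d, fun e => ?_, hdc, fun e he => hdj e (by omega),
          e11, ?_, fun _ => hdc'⟩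
        · rw [Memory.set_of_ne _ _ _ (by decide), Memory.set_of_ne _ _ _ (by decide), hd7]
        · rw [e11, sum_ite_lt_succ _ hj, ← hacc, hdc']
          linarith [hcu ⟨j, hj⟩]
  · rintro τ hτ ⟨hs, d, hd7, hdc, -, hacc, h3, h2⟩
    rw [sum_ite_lt_self] at hacc
    rw [hacc] at h2 h3
    exact ⟨hs, d, hd7, hdc, hacc, h3, h2⟩

theorem run_give (h : Caps n m B I U S K L) (hσ : Fits (cap I U B S) σ) (hst : Holds st σ)
    {i : Fin n} (hi : σ 12 0 = (i : ℕ)) {d : Fin m → ℚ} (hd : ∀ e : Fin m, σ 7 e = d e) :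
    Run O (cap I U B S) K L giveProg σ fun τ => Same [0, 5, 15] σ τ ∧ Holds (st.give i d) τ := by
  have hnI := h.n_le_I
  have hUB := h.B_le
  refine Run.mono (Run.for h.cap_le hσ h.m_le (by simp only [cap]; omega)
    (fun j τ => Same [0, 5, 15] σ τ ∧ ∀ e : Fin m,
      ((e : ℕ) < j → τ 0 e = ((st.give i d).own e : ℕ) ∧ τ 5 e = (st.give i d).C e) ∧
      (j ≤ e → τ 0 e = (st.own e : ℕ) ∧ τ 5 e = st.C e))
    ⟨(Same.refl _ _).set (by decide), fun e => ⟨by simp, fun _ => ?_⟩⟩ ?_ ?_) ?_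
  · rw [Memory.set_of_ne _ _ _ (by decide), Memory.set_of_ne _ _ _ (by decide)]
    exact ⟨hst.own e, hst.C e⟩
  · rintro j τ ⟨hs, -⟩
    rw [hs 1 (by decide), hst.items]
  · rintro j hj τ hτ hv ⟨hs, hinv⟩
    have hown := ((hinv ⟨j, hj⟩).2 le_rfl).1
    have hC := ((hinv ⟨j, hj⟩).2 le_rfl).2
    have hd' : (Expr.at 7 15).eval τ = d ⟨j, hj⟩ := by
      rw [Expr.eval_at hv, hs 7 (by decide), ← hd]
    have hi' : τ 12 0 = (i : ℕ) := by rw [hs 12 (by decide), hi]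
    have hu : (Expr.at 4 12).eval τ = st.u i := by
      rw [Expr.eval_at hi', hs 4 (by decide), ← hst.u]
    have ho : (Expr.at 0 15).eval τ = (st.own ⟨j, hj⟩ : ℕ) := by rw [Expr.eval_at hv, ← hown]
    have fin : ∀ ρ : Memory, ρ 15 0 = j → Same [0, 5, 15] σ ρ →
        (∀ k, k ≠ j → ρ 0 k = τ 0 k ∧ ρ 5 k = τ 5 k) →
        ρ 0 j = ((st.give i d).own ⟨j, hj⟩ : ℕ) → ρ 5 j = (st.give i d).C ⟨j, hj⟩ →
        ρ 15 0 = j ∧ Same [0, 5, 15] σ (ρ.set 15 0 (j + 1 : ℕ)) ∧ ∀ e : Fin m,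
          ((e : ℕ) < j + 1 → ρ.set 15 0 (j + 1 : ℕ) 0 e = ((st.give i d).own e : ℕ) ∧
            ρ.set 15 0 (j + 1 : ℕ) 5 e = (st.give i d).C e) ∧
          (j + 1 ≤ e → ρ.set 15 0 (j + 1 : ℕ) 0 e = (st.own e : ℕ) ∧
            ρ.set 15 0 (j + 1 : ℕ) 5 e = st.C e) := by
      intro ρ hvρ hsρ hother h0 h5
      refine ⟨hvρ, hsρ.set (by decide), fun e => ?_⟩
      rw [Memory.set_of_ne _ _ _ (by decide), Memory.set_of_ne _ _ _ (by decide)]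
      refine ⟨fun he => ?_, fun he => ?_⟩
      · rcases Nat.lt_succ_iff_lt_or_eq.1 he with he | he
        · rw [(hother e he.ne).1, (hother e he.ne).2]
          exact (hinv e).1 he
        · obtain rfl : e = ⟨j, hj⟩ := Fin.ext he
          exact ⟨h0, h5⟩
      · have hne : (e : ℕ) ≠ j := by omega
        rw [(hother e hne).1, (hother e hne).2]
        exact (hinv e).2 (by omega)
    refine Run.ite h.cap_le hτ (fun hle => ?_) fun hlt => ?_
    · simp only [hd', Expr.eval] at hle
      -- The machine only tests `≤`, so equality of agents is tested by a square being at most zero.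
      have hsq : (Expr.mul (.sub (.at 0 15) (.rd 12)) (.sub (.at 0 15) (.rd 12))).eval τ ≤ 0 ↔
          st.own ⟨j, hj⟩ = i := by
        simp only [Expr.eval, ho, Expr.eval_rd, hi']
        rw [← sq, sq_nonpos_iff, sub_eq_zero, Nat.cast_inj, Fin.ext_iff]
      refine Run.ite h.cap_le hτ (fun hle2 => ?_) fun hlt2 => ?_
      · have hoi := hsq.1 hle2
        refine Run.assign h.cap_le hτ (by simp only [Expr.eval, ht_zero, cap]; omega) ?_
        simp only [Expr.eval_rd, hv, Nat.floor_natCast, Expr.eval]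
        refine fin _ ?_ (hs.set (by decide)) (fun k hk => ?_) ?_ ?_
        · rw [Memory.set_of_ne _ _ _ (by decide), hv]
        · simp [Memory.set_apply, hk]
        · rw [Memory.set_of_ne _ _ _ (by decide)]
          simpa [State.give, hle] using hown
        · simp [Memory.set_apply, State.give, hle, hoi]
      · have hoi : st.own ⟨j, hj⟩ ≠ i := fun hc => not_le.2 hlt2 (hsq.2 hc)
        refine Run.skip hτ (fin _ hv hs (fun k _ => ⟨rfl, rfl⟩) ?_ ?_)
        · simpa [State.give, hle] using hown
        · simpa [State.give, hle, hoi] using hC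
    · simp only [hd', Expr.eval] at hlt
      have hin := i.2
      refine Run.assign_seq h.cap_le hτ ?_ fun hF => ?_
      · rw [Expr.eval_rd, hi']
        exact (ht_natCast _).trans (by simp only [cap]; omega)
      simp only [Expr.eval_rd, hv, hi', Nat.floor_natCast] at hF ⊢
      have hv' : (τ.set 0 j (i : ℕ)) 15 0 = j := by
        rw [Memory.set_of_ne _ _ _ (by decide), hv]
      have hval : (Expr.div (.at 7 15) (.at 4 12)).eval (τ.set 0 j (i : ℕ)) =
          d ⟨j, hj⟩ / st.u i := by
        have hi2 : (τ.set 0 j (i : ℕ)) 12 0 = (i : ℕ) := by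
          rw [Memory.set_of_ne _ _ _ (by decide), hi']
        rw [Expr.eval, Expr.eval_at hv', Expr.eval_at hi2, Memory.set_of_ne _ _ _ (by decide),
          Memory.set_of_ne _ _ _ (by decide), ← Expr.eval_at hv, hd', ← Expr.eval_at hi', hu]
      refine Run.assign h.cap_le hF ?_ ?_
      · rw [hval]
        -- The new contribution is computed afresh from the gift and the unit and does not involve
        -- old contributions, so heights do not accumulate.
        refine (ht_div _ _).trans ?_
        have h7 := hσ 7 j
        have h4 := hσ 4 i
        rw [hd ⟨j, hj⟩] at h7
        rw [hst.u] at h4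
        simp only [cap] at h7 h4 ⊢
        omega
      · rw [hval]
        simp only [Expr.eval_rd, hv', Nat.floor_natCast]
        refine fin _ ?_ ((hs.set (by decide)).set (by decide)) (fun k hk => ?_) ?_ ?_
        · rw [Memory.set_of_ne _ _ _ (by decide), hv']
        · simp [Memory.set_apply, hk]
        · simp [Memory.set_apply, State.give, not_le.2 hlt]
        · simp [Memory.set_apply, State.give, not_le.2 hlt]
  · rintro τ hτ ⟨hs, hinv⟩
    exact ⟨hs, fun e => ((hinv e).1 e.2).1, fun e => ((hinv e).1 e.2).2,
      fun k => by rw [hs 4 (by decide), hst.u]; rfl, by rw [hs 1 (by decide), hst.items],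
      by rw [hs 2 (by decide), hst.agents], fun k => by rw [hs 6 (by decide), hst.query]⟩

/-- The height of the new unit is a hypothesis because the product rule, applied round after round,
would exceed any fixed cap. -/
theorem run_reduce (h : Caps n m B I U S K L) (hσ : Fits (cap I U B S) σ) (hst : Holds st σ)
    {i : Fin n} (hi : σ 12 0 = (i : ℕ)) (hU : ht (st.u i * (1 - 1 / (8 * n))) ≤ U) :
    Run O (cap I U B S) K L reduceProg σ fun τ =>
      Same [4, 5, 15] σ τ ∧ Holds (st.reduce i) τ := by
  have hnI := h.n_le_I
  have hval : (Expr.mul (.at 4 12) (.sub (.const 1) (.div (.const 1) (.mul (.const 8)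
      (.rd 2))))).eval σ = st.u i * (1 - 1 / (8 * n)) := by
    simp only [Expr.eval, Expr.eval_at hi, hst.u, Expr.eval_rd, hst.agents]
  refine Run.assign_seq h.cap_le hσ (by rw [hval]; exact hU) fun hF => ?_
  rw [hval] at hF ⊢
  simp only [Expr.eval_rd, hi, Nat.floor_natCast] at hF ⊢
  refine Run.mono (Run.map h.cap_le hF h.m_le (x := 5) (by simp only [cap]; omega)
    (by decide) (by decide) (by rw [Memory.set_of_ne _ _ _ (by decide), hst.items])
    (fun _ => 0) ?_) ?_
  · intro j hj τ hτ hv hs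
    refine Run.assign h.cap_le hτ (by simp only [Expr.eval, ht_zero, cap]; omega) ?_
    simp [Expr.eval, hv]
  · rintro τ hτ ⟨hs, hC⟩
    have hs' : Same [4, 5, 15] σ τ :=
      ((Same.refl [4] σ).set (by decide)).trans hs (by decide) (by decide)
    refine ⟨hs', fun e => by rw [hs' 0 (by decide), hst.own]; rfl, fun e => hC e e.2,
      fun k => ?_, by rw [hs' 1 (by decide), hst.items],
      by rw [hs' 2 (by decide), hst.agents], fun k => by rw [hs' 6 (by decide), hst.query]⟩
    rw [hs 4 (by decide), Memory.set_apply, hst.u]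
    simp [State.reduce, Function.update_apply, Fin.ext_iff]

theorem ht_factor_le [NeZero n] : ht (1 - 1 / (8 * n) : ℚ) ≤ 8 * n + 1 := by
  have hn : 1 ≤ n := NeZero.one_le
  have hn' : (n : ℚ) ≠ 0 := by exact_mod_cast NeZero.ne n
  refine ht_le_of_divInt (a := 8 * n - 1) (b := 8 * n) (by omega) ?_ ?_ ?_
  · push_cast
    field_simp
  · refine (Nat.size_le_size (n := 8 * n) (by omega)).trans (size_le_self_add_one _)
  · refine (Nat.size_le_size (n := 8 * n) (by omega)).trans (size_le_self_add_one _)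

/-- The closed form of the unit in the invariant bounds its height by the number of reductions,
however the value was computed. -/
theorem ht_reduced_unit_le [NeZero n] (h : Caps n m B I U S K L)
    {V : Fin n → Finset (Fin m) → ℚ} {w : Fin n → ℚ} {f : Fin n → ℕ} (hI : State.Inv V w f st)
    (hwB : ∀ k, ht (w k) ≤ B + 1) (i : Fin n) : ht (st.u i * (1 - 1 / (8 * n))) ≤ U := by
  rw [hI.u_eq, mul_assoc, ← pow_succ]
  have h1 := ht_mul (m * w i) ((1 - 1 / (8 * n)) ^ (f i + 1))
  have h2 := ht_mul m (w i)
  have h3 := ht_natCast m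
  have h4 := ht_pow (1 - 1 / (8 * n)) (f i + 1)
  have h5 : (f i + 1) * ht (1 - 1 / (8 * n) : ℚ) ≤ (64 * n * m + 1) * (8 * n + 1) :=
    Nat.mul_le_mul (Nat.succ_le_succ (hI.f_le i)) ht_factor_le
  have h6 := hwB i
  have h7 := h.U_le
  omega

theorem run_demand [NeZero n] (h : Caps n m B I U S K L) {V : Fin n → Finset (Fin m) → ℚ}
    (hV : ∀ i, IsXOSValuation (V i)) (hD : ∀ i, IsDemandOracle (V i) (O.demand i))
    (hX : ∀ i, IsXOSOracle (V i) (O.xos i)) (hB : ∀ i S, ∀ j ∈ S, bitSize (O.xos i S j) ≤ B)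
    {w : Fin n → ℚ} (hw : ∀ k, 0 ≤ w k) {f : Fin n → ℕ} (hI : State.Inv V w f st)
    (hσ : Fits (cap I U B S) σ) (hst₄ : Holds st σ) {i : Fin n} (hi₄ : σ 12 0 = (i : ℕ))
    (hun : st.Unsat i) (hrow₄ : ∀ e : Fin m, σ 8 e = V i {e}) (h0 : σ 13 0 = 0)
    (hsmall : ∀ e, st.C e < 1 → V i {e} < st.u i) :
    Run O (cap I U B S) K L demandProg σ fun τ => Same [7, 9, 10, 11, 13, 15] σ τ ∧ Holds st τ ∧
      τ 12 0 = (i : ℕ) ∧ ((τ 13 0 = 0 ∧ mms (V i) n < (8 - 1 / n) * st.u i) ∨ (τ 13 0 = 1 ∧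
        ∃ d : Fin m → ℚ, (∀ e : Fin m, τ 7 e = d e) ∧ st.Gift V i d)) := by
  have hnI := h.n_le_I
  have hUB := h.B_le
  have hu := hI.u_pos hw hun
  refine Run.seq (run_price h hσ hst₄ hi₄ hrow₄) ?_
  rintro τ₅ hτ₅ ⟨hs₅, hp₅⟩
  have hi₅ : τ₅ 12 0 = (i : ℕ) := by rw [hs₅ 12 (by decide), hi₄]
  have hs₅' : Same [9, 15] σ τ₅ :=
    hs₅.trans (Same.refl [] _) (by decide) (by decide)
  have hq₅ : ∀ k, τ₅ 6 k = 0 := fun k => by rw [hs₅ 6 (by decide), hst₄.query]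
  refine Run.seq (Q' := fun τ => τ = τ₅.setVec 10 (O.demandVec i (τ₅.vec m 9)))
    (Run.demand h.cap_le hτ₅ h.m_le i (by rw [Expr.eval_rd, hi₅])
      (by simp only [cap]; omega) rfl) ?_
  rintro τ₆ hτ₆ hdef₆
  have hs₆ : Same [10] τ₅ τ₆ := by
    rw [hdef₆]
    exact (Same.refl _ _).setVec (by decide)
  have hi₆ : τ₆ 12 0 = (i : ℕ) := by rw [hs₆ 12 (by decide), hi₅]
  refine Run.seq (Q' := fun τ => τ = τ₆.setVec 7 (O.xosVec i (τ₆.vec m 10)))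
    (Run.xos h.cap_le hτ₆ h.m_le i (by rw [Expr.eval_rd, hi₆]) (fun e => ?_) rfl) ?_
  · unfold Oracles.xosVec
    split_ifs with he
    · refine (ht_le_bitSize _).trans ((hB i _ e (by simpa using he)).trans ?_)
      simp only [cap]; omega
    · simp only [ht_zero, cap]; omega
  rintro τ₇ hτ₇ hdef₇
  have hs₇ : Same [7] τ₆ τ₇ := by
    rw [hdef₇]
    exact (Same.refl _ _).setVec (by decide)
  have hi₇ : τ₇ 12 0 = (i : ℕ) := by rw [hs₇ 12 (by decide), hi₆]
  have hs₇' : Same [7, 9, 10, 15] σ τ₇ :=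
    (hs₅'.trans hs₆ (Z := [7, 9, 10, 15]) (by decide) (by decide)).trans
      hs₇ (by decide) (by decide)
  have hst₇ : Holds st τ₇ :=
    hst₄.of_same hs₇' (by decide) (by decide) (by decide) (by decide) (by decide)
      fun k => by rw [hs₇ 6 (by decide), hs₆ 6 (by decide), hq₅]
  have hmem : ∀ e : Fin m, τ₆.vec m 10 e ≠ 0 ↔ e ∈ O.demand i (τ₅.vec m 9) := fun e => by
    rw [hdef₆, Memory.vec, Memory.setVec_self]
    simp [Oracles.demandVec]
  have hc : ∀ e : Fin m, τ₇ 7 e = if e ∈ O.demand i (τ₅.vec m 9) then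
      O.xos i (O.demand i (τ₅.vec m 9)) e else 0 := fun e => by
    rw [hdef₇, Memory.setVec_self, Oracles.xosVec]
    simp only [hmem, Finset.filter_mem_eq_inter, Finset.univ_inter]
  obtain ⟨hcu, hgift⟩ := hI.gift_demand hw (hD i) (hX i) (hV i) hun (p := τ₅.vec m 9) hp₅ hsmall
    (c := fun e => τ₇ 7 e) hc
  refine Run.seq (run_trim h hτ₇ hst₇ hi₇ (c := fun e => τ₇ 7 e) (fun _ => rfl) hcu hu) ?_
  rintro τ₈ hτ₈ ⟨hs₈, d, hd, hdc, hacc, h3, h2⟩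
  have hs₈' : Same [7, 9, 10, 11, 15] σ τ₈ :=
    hs₇'.trans hs₈ (by decide) (by decide)
  have hst₈ := hst₇.of_same hs₈ (by decide) (by decide) (by decide) (by decide) (by decide)
    fun k => by rw [hs₈ 6 (by decide), hst₇.query]
  have hi₈ : τ₈ 12 0 = (i : ℕ) := by rw [hs₈ 12 (by decide), hi₇]
  have hu₈ : (Expr.mul (.const 2) (.at 4 12)).eval τ₈ = 2 * st.u i := by
    rw [Expr.eval, Expr.eval_at hi₈, hst₈.u, Expr.eval]
  refine Run.ite h.cap_le hτ₈ (fun hle => ?_) fun hlt => ?_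
  · rw [hu₈, Expr.eval_rd, hacc] at hle
    refine Run.assign h.cap_le hτ₈ (by simp only [Expr.eval, ht_one, cap]; omega) ?_
    simp only [Expr.eval, Nat.floor_zero]
    have hs : Same [13] τ₈ (τ₈.set 13 0 1) := (Same.refl _ _).set (by decide)
    refine ⟨(hs₈'.trans (Same.refl [] _) (by decide) (by decide)).set (by decide),
      hst₈.of_same hs (by decide) (by decide) (by decide) (by decide) (by decide) fun k => by rw [hs 6 (by decide), hst₈.query], ?_,
      .inr ⟨by simp [Memory.set_apply], d, fun e => ?_, hgift d hdc hle h3⟩⟩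
    · rw [hs 12 (by decide), hi₈]
    · rw [hs 7 (by decide), hd]
  · rw [hu₈, Expr.eval_rd, hacc] at hlt
    refine Run.skip hτ₈ ⟨hs₈'.trans (Same.refl [] _) (by decide) (by decide), hst₈, hi₈,
      .inl ⟨?_, ?_⟩⟩
    · rw [hs₈ 13 (by decide), hs₇ 13 (by decide), hs₆ 13 (by decide), hs₅ 13 (by decide), h0]
    -- If the guess were right, the demanded set would be worth two units. Its contributions sum to
    -- its value, and a total below two units means that none was trimmed: contradiction.
    · by_contra! hmms
      have h4 := hI.two_mul_le_demand hw (hD i) (hV i) hun hmms (p := τ₅.vec m 9) hp₅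
      rw [← (hX i _).1] at h4
      rw [h2 hlt] at hlt
      simp only [hc, Finset.sum_ite_mem, Finset.univ_inter] at hlt
      linarith

theorem run_round [NeZero n] (h : Caps n m B I U S K L) {V : Fin n → Finset (Fin m) → ℚ}
    (hV : ∀ i, IsXOSValuation (V i)) (hD : ∀ i, IsDemandOracle (V i) (O.demand i))
    (hX : ∀ i, IsXOSOracle (V i) (O.xos i)) (hB : ∀ i S, ∀ j ∈ S, bitSize (O.xos i S j) ≤ B)
    {w : Fin n → ℚ} (hw : ∀ k, 0 ≤ w k) (hwB : ∀ k, ht (w k) ≤ B + 1) {f : Fin n → ℕ}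
    (hI : State.Inv V w f st) (hσ : Fits (cap I U B S) σ) (hst : Holds st σ) :
    Run O (cap I U B S) K L roundProg σ fun τ =>
      Same [0, 4, 5, 6, 7, 8, 9, 10, 11, 12, 13, 15, 17, 19] σ τ ∧
        ∃ st', Holds st' τ ∧ ((st' = st ∧ ∀ k, ¬ st.Unsat k) ∨ State.Step V st st') := by
  have hnI := h.n_le_I
  have hUB := h.B_le
  refine Run.seq (run_scan h hσ hst) ?_
  rintro τ₁ hτ₁ ⟨hs₁, hor⟩
  have hst₁ := hst.of_same hs₁ (by decide) (by decide) (by decide) (by decide) (by decide)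
    fun k => by rw [hs₁ 6 (by decide), hst.query]
  refine Run.ite h.cap_le hτ₁ (fun hle => ?_) fun hlt => ?_
  swap
  · rw [Expr.eval, Expr.eval_rd] at hlt
    rcases hor with ⟨-, hsat⟩ | ⟨i, hi, -⟩
    · exact Run.skip hτ₁ ⟨hs₁.trans (Same.refl [] _) (by decide) (by decide),
        st, hst₁, .inl ⟨rfl, hsat⟩⟩
    · rw [hi] at hlt
      have : i.val + 1 < 1 := by exact_mod_cast hlt
      omega
  rw [Expr.eval, Expr.eval_rd] at hle
  rcases hor with ⟨h0, -⟩ | ⟨i, hi, hun⟩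
  · rw [h0] at hle
    norm_num at hle
  have hin := i.2
  have hu := hI.u_pos hw hun
  have hival : (Expr.sub (.rd 19) (.const 1)).eval τ₁ = (i : ℕ) := by
    simp [Expr.eval, hi]
  refine Run.assign_seq h.cap_le hτ₁ ?_ fun hF => ?_
  · rw [hival]
    exact (ht_natCast _).trans (by simp only [cap]; omega)
  rw [hival] at hF ⊢
  simp only [Expr.eval, Nat.floor_zero] at hF ⊢
  have hs₂ : Same [12, 15, 17, 19] σ (τ₁.set 12 0 (i : ℕ)) :=
    (hs₁.trans (Same.refl [] _) (by decide) (by decide)).set (by decide)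
  have hst₂ := hst.of_same hs₂ (by decide) (by decide) (by decide) (by decide) (by decide)
    fun k => by rw [hs₂ 6 (by decide), hst.query]
  have hi₂ : (τ₁.set 12 0 (i : ℕ)) 12 0 = (i : ℕ) := by simp [Memory.set_apply]
  refine Run.seq (run_row h hX hB hF hst₂.items hst₂.query hi₂) ?_
  rintro τ₃ hτ₃ ⟨hs₃, hq₃, hrow₃⟩
  have hst₃ := hst₂.of_same hs₃ (by decide) (by decide) (by decide) (by decide) (by decide) hq₃
  have hi₃ : τ₃ 12 0 = (i : ℕ) := by rw [hs₃ 12 (by decide), hi₂]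
  have hs₃' : Same [6, 7, 8, 12, 15, 17, 19] σ τ₃ := hs₂.trans hs₃ (by decide) (by decide)
  refine Run.seq (run_single h hτ₃ hst₃ hi₃ hrow₃) ?_
  rintro τ₄ hτ₄ ⟨hs₄, hor₄⟩
  have hst₄ := hst₃.of_same hs₄ (by decide) (by decide) (by decide) (by decide) (by decide)
    fun k => by rw [hs₄ 6 (by decide), hst₃.query]
  have hi₄ : τ₄ 12 0 = (i : ℕ) := by rw [hs₄ 12 (by decide), hi₃]
  have hs₄' : Same [6, 7, 8, 12, 13, 15, 17, 19] σ τ₄ := hs₃'.trans hs₄ (by decide) (by decide)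
  refine Run.seq (Q' := fun τ => Same [6, 7, 8, 9, 10, 11, 12, 13, 15, 17, 19] σ τ ∧ Holds st τ ∧
    τ 12 0 = (i : ℕ) ∧ ((τ 13 0 = 0 ∧ mms (V i) n < (8 - 1 / n) * st.u i) ∨ (τ 13 0 = 1 ∧
      ∃ d : Fin m → ℚ, (∀ e : Fin m, τ 7 e = d e) ∧ st.Gift V i d))) ?_ ?_
  · refine Run.ite h.cap_le hτ₄ (fun hle => ?_) fun hlt => ?_
    · rw [Expr.eval, Expr.eval_rd] at hle
      rcases hor₄ with ⟨h0, -⟩ | ⟨h1, e₀, hC₀, hu₀, hall⟩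
      · rw [h0] at hle
        norm_num at hle
      · exact Run.skip hτ₄ ⟨hs₄'.trans (Same.refl [] _) (by decide) (by decide), hst₄, hi₄,
          .inr ⟨h1, _, hall, hI.gift_singleton hw (hV i) hun hC₀ hu₀⟩⟩
    rw [Expr.eval, Expr.eval_rd] at hlt
    rcases hor₄ with ⟨h0, hsmall⟩ | ⟨h1, -⟩
    swap
    · rw [h1] at hlt
      exact absurd hlt (lt_irrefl _)
    refine (run_demand h hV hD hX hB hw hI hτ₄ hst₄ hi₄ hun
      (fun e => by rw [hs₄ 8 (by decide), hrow₃]) h0 hsmall).mono ?_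
    rintro τ hτ ⟨hs, hrest⟩
    exact ⟨hs₄'.trans hs (by decide) (by decide), hrest⟩
  rintro τ hτ ⟨hs, hst, hi, hor⟩
  refine Run.ite h.cap_le hτ (fun hle => ?_) fun hlt => ?_
  · rw [Expr.eval, Expr.eval_rd] at hle
    rcases hor with ⟨h0, -⟩ | ⟨-, d, hd, hgift⟩
    · rw [h0] at hle
      norm_num at hle
    · refine (run_give h hτ hst hi hd).mono ?_
      rintro ρ hρ ⟨hsρ, hstρ⟩
      exact ⟨hs.trans hsρ (by decide) (by decide), _, hstρ, .inr ⟨i, hun, .inl ⟨d, hgift, rfl⟩⟩⟩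
  · rw [Expr.eval, Expr.eval_rd] at hlt
    rcases hor with ⟨-, hmms⟩ | ⟨h1, -⟩
    · refine (run_reduce h hτ hst hi (ht_reduced_unit_le h hI hwB i)).mono ?_
      rintro ρ hρ ⟨hsρ, hstρ⟩
      exact ⟨hs.trans hsρ (by decide) (by decide), _, hstρ, .inr ⟨i, hun, .inr ⟨hmms, rfl⟩⟩⟩
    · rw [h1] at hlt
      exact absurd hlt (lt_irrefl _)

/-! ### The first units -/

/-- `w` is the `n`-th largest of the numbers `v e`, or zero if there are fewer than `n`. -/
structure IsRank {m : ℕ} (n : ℕ) (v : Fin m → ℚ) (w : ℚ) : Prop where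
  nonneg : 0 ≤ w
  attained : w = 0 ∨ ∃ e, w = v e ∧ n ≤ (Finset.univ.filter fun e' => v e ≤ v e').card
  le : ∀ e, n ≤ (Finset.univ.filter fun e' => v e ≤ v e').card → v e ≤ w

theorem IsRank.le_mms [NeZero n] {V : Finset (Fin m) → ℚ} {w : ℚ}
    (h : IsRank n (fun e => V {e}) w) (hV : IsXOSValuation V) : w ≤ mms V n := by
  rcases h.attained with rfl | ⟨e, rfl, he⟩
  · exact FairAllocation.le_mms (fun _ => 0) fun j => hV.nonneg _
  · exact le_mms_of_card_le hV he

/-- Fewer than `n` items exceed `w`: otherwise the least valuable of those would have `n` items at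
or above it, and `w` would be at least its value. -/
theorem IsRank.mms_le [NeZero n] {V : Finset (Fin m) → ℚ} {X : Finset (Fin m) → Fin m → ℚ} {w : ℚ}
    (h : IsRank n (fun e => V {e}) w) (hX : IsXOSOracle V X) : mms V n ≤ m * w := by
  refine mms_le_of_card_lt hX h.nonneg (lt_of_not_ge fun hc => ?_)
  obtain ⟨e, he, hmin⟩ := Finset.exists_min_image _ (fun e => V {e})
    (Finset.card_pos.1 (lt_of_lt_of_le (NeZero.pos n) hc))
  have h1 := h.le e (hc.trans (Finset.card_le_card fun e' he' => by simpa using hmin e' he'))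
  exact not_lt.2 h1 (Finset.mem_filter.1 he).2

/-- Instead of sorting, the program counts for each item how many items are at least as valuable,
and takes the maximum value over the items whose count reaches `n`. -/
theorem run_rank (h : Caps n m B I U S K L) (hσ : Fits (cap I U B S) σ) (hm : σ 1 0 = m)
    (hn : σ 2 0 = n) {v : Fin m → ℚ} (hrow : ∀ e : Fin m, σ 8 e = v e) (hv0 : ∀ e, 0 ≤ v e) :
    Run O (cap I U B S) K L rankProg σ fun τ => Same [11, 15, 16, 18] σ τ ∧
      IsRank n v (τ 11 0) := by
  have hnI := h.n_le_I
  have hSle := h.S_le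
  refine Run.assign_seq h.cap_le hσ (by simp only [Expr.eval, ht_zero, cap]; omega) fun hF => ?_
  simp only [Expr.eval, Nat.floor_zero] at hF ⊢
  refine Run.mono (Run.for h.cap_le hF h.m_le (by simp only [cap]; omega)
    (fun j τ => Same [11, 15, 16, 18] σ τ ∧ 0 ≤ τ 11 0 ∧
      (τ 11 0 = 0 ∨ ∃ e, τ 11 0 = v e ∧ n ≤ (Finset.univ.filter fun e' => v e ≤ v e').card) ∧
      ∀ e : Fin m, (e : ℕ) < j → n ≤ (Finset.univ.filter fun e' => v e ≤ v e').card →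
        v e ≤ τ 11 0)
    ⟨((Same.refl _ _).set (by decide)).set (by decide), ?_, ?_, by simp⟩ ?_ ?_) ?_
  · simp [Memory.set_apply]
  · simp [Memory.set_apply]
  · rintro j τ ⟨hs, -⟩
    rw [hs 1 (by decide), hm]
  · rintro j hj τ hτ hv ⟨hs, h0, hatt, hle⟩
    have hvb : ht (v ⟨j, hj⟩) ≤ B + 1 := by
      rw [← hrow]
      exact hσ 8 j
    refine Run.assign_seq h.cap_le hτ (by simp only [Expr.eval, ht_zero, cap]; omega) fun hF => ?_
    simp only [Expr.eval, Nat.floor_zero] at hF ⊢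
    refine Run.seq (Run.for h.cap_le hF h.m_le (by simp only [cap]; omega)
      (fun l ρ => Same [16, 18] τ ρ ∧ ∃ c : ℕ, c ≤ l ∧ ρ 18 0 = c ∧
        (c : ℚ) = ∑ e : Fin m, if (e : ℕ) < l then if v ⟨j, hj⟩ ≤ v e then 1 else 0 else 0)
      ⟨((Same.refl _ _).set (by decide)).set (by decide), 0, le_rfl, ?_, by simp⟩ ?_ ?_) ?_
    · simp [Memory.set_apply]
    · rintro l ρ ⟨hsρ, -⟩
      rw [hsρ 1 (by decide), hs 1 (by decide), hm]
    · rintro l hl ρ hρ hvl ⟨hsρ, c, hcl, hc, hsum⟩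
      have e1 : (Expr.at 8 15).eval ρ = v ⟨j, hj⟩ := by
        rw [Expr.eval_at (by rw [hsρ 15 (by decide), hv]), hsρ 8 (by decide), hs 8 (by decide),
          ← hrow]
      have e2 : (Expr.at 8 16).eval ρ = v ⟨l, hl⟩ := by
        rw [Expr.eval_at hvl, hsρ 8 (by decide), hs 8 (by decide), ← hrow]
      refine Run.ite h.cap_le hρ (fun hle => ?_) fun hlt => ?_
      · rw [e1, e2] at hle
        have e3 : (Expr.add (.rd 18) (.const 1)).eval ρ = (c + 1 : ℕ) := by simp [Expr.eval, hc]
        refine Run.assign h.cap_le hρ ?_ ?_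
        · rw [e3]
          exact (ht_natCast _).trans (by simp only [cap]; omega)
        · rw [e3]
          simp only [Expr.eval, Nat.floor_zero]
          refine ⟨by rw [Memory.set_of_ne _ _ _ (by decide), hvl],
            (hsρ.set (by decide)).set (by decide), c + 1, by omega, ?_, ?_⟩
          · rw [Memory.set_of_ne _ _ _ (by decide)]
            simp [Memory.set_apply]
          · rw [sum_ite_lt_succ _ hl, ← hsum, if_pos hle]
            push_cast
            rfl
      · rw [e1, e2] at hlt
        refine Run.skip hρ ⟨hvl, hsρ.set (by decide), c, by omega, ?_, ?_⟩
        · rw [Memory.set_of_ne _ _ _ (by decide), hc]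
        · rw [sum_ite_lt_succ _ hl, ← hsum, if_neg (not_le.2 hlt), add_zero]
    rintro ρ hρ ⟨hsρ, c, -, hc, hsum⟩
    have hcard : c = (Finset.univ.filter fun e' => v ⟨j, hj⟩ ≤ v e').card := by
      rw [sum_ite_lt_self, Finset.sum_boole] at hsum
      exact_mod_cast hsum
    have hsσ : Same [11, 15, 16, 18] σ ρ := hs.trans hsρ (by decide) (by decide)
    have hv' : ρ 15 0 = j := by rw [hsρ 15 (by decide), hv]
    have h11 : ρ 11 0 = τ 11 0 := by rw [hsρ 11 (by decide)]
    have hr : (Expr.at 8 15).eval ρ = v ⟨j, hj⟩ := by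
      rw [Expr.eval_at hv', hsσ 8 (by decide), ← hrow]
    have keep : (n ≤ (Finset.univ.filter fun e' => v ⟨j, hj⟩ ≤ v e').card →
        v ⟨j, hj⟩ ≤ τ 11 0) → Run O (cap I U B S) K L .skip ρ fun μ => μ 15 0 = j ∧
        (Same [11, 15, 16, 18] σ (μ.set 15 0 (j + 1 : ℕ)) ∧
          0 ≤ (μ.set 15 0 (j + 1 : ℕ)) 11 0 ∧
          ((μ.set 15 0 (j + 1 : ℕ)) 11 0 = 0 ∨ ∃ e, (μ.set 15 0 (j + 1 : ℕ)) 11 0 = v e ∧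
            n ≤ (Finset.univ.filter fun e' => v e ≤ v e').card) ∧
          ∀ e : Fin m, (e : ℕ) < j + 1 → n ≤ (Finset.univ.filter fun e' => v e ≤ v e').card →
            v e ≤ (μ.set 15 0 (j + 1 : ℕ)) 11 0) := by
      intro hnew
      have h11' : (ρ.set 15 0 (j + 1 : ℕ)) 11 0 = τ 11 0 := by
        rw [Memory.set_of_ne _ _ _ (by decide), h11]
      refine Run.skip hρ ⟨hv', hsσ.set (by decide), ?_, ?_, fun e he hn => ?_⟩
      · rwa [h11']
      · rwa [h11']
      · rw [h11']
        rcases Nat.lt_succ_iff_lt_or_eq.1 he with he | he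
        · exact hle e he hn
        · obtain rfl : e = ⟨j, hj⟩ := Fin.ext he
          exact hnew hn
    refine Run.ite h.cap_le hρ (fun hnle => ?_) fun hlt => ?_
    swap
    · rw [Expr.eval_rd, Expr.eval_rd, hsσ 2 (by decide), hn, hc, hcard, Nat.cast_lt] at hlt
      exact keep fun hn => absurd hn (not_le.2 hlt)
    rw [Expr.eval_rd, Expr.eval_rd, hsσ 2 (by decide), hn, hc, hcard, Nat.cast_le] at hnle
    refine Run.ite h.cap_le hρ (fun hwle => ?_) fun hlt => ?_
    swap
    · rw [Expr.eval_rd, hr, h11] at hlt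
      exact keep fun _ => hlt.le
    rw [Expr.eval_rd, hr, h11] at hwle
    refine Run.assign h.cap_le hρ (by rw [hr]; simp only [cap]; omega) ?_
    rw [hr]
    simp only [Expr.eval, Nat.floor_zero]
    have h11' : ((ρ.set 11 0 (v ⟨j, hj⟩)).set 15 0 (j + 1 : ℕ)) 11 0 = v ⟨j, hj⟩ := by
      rw [Memory.set_of_ne _ _ _ (by decide)]
      simp [Memory.set_apply]
    refine ⟨by rw [Memory.set_of_ne _ _ _ (by decide), hv'],
      (hsσ.set (by decide)).set (by decide), ?_, .inr ⟨_, h11', hnle⟩, fun e he hn => ?_⟩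
    · rw [h11']
      exact hv0 _
    · rw [h11']
      rcases Nat.lt_succ_iff_lt_or_eq.1 he with he | he
      · exact (hle e he hn).trans hwle
      · obtain rfl : e = ⟨j, hj⟩ := Fin.ext he
        exact le_rfl
  · rintro τ hτ ⟨hs, h0, hatt, hle⟩
    exact ⟨hs, h0, hatt, fun e => hle e e.2⟩

theorem run_const (h : Caps n m B I U S K L) (hσ : Fits (cap I U B S) (inputMemory n m)) :
    Run O (cap I U B S) K L constProg (inputMemory n m) fun τ =>
      τ 1 0 = m ∧ τ 2 0 = n ∧ τ 3 0 = (1600 * (n + m) ^ 6 : ℕ) ∧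
        ∀ k, τ 0 k = 0 ∧ τ 5 k = 0 ∧ τ 6 k = 0 := by
  have hnI := h.n_le_I
  have hN := h.N_le
  have hIL := h.L_le
  refine Run.setS_seq h.cap_le hσ (q := n) (by simp [inputMemory])
    ((ht_natCast _).trans (by simp only [cap]; omega)) fun hF => ?_
  refine Run.setS_seq h.cap_le hF (q := 0) rfl (by simp only [ht_zero, cap]; omega) fun hF => ?_
  refine Run.setS_seq h.cap_le hF (q := (n + m : ℕ))
    (by simp [Expr.eval, Memory.set_apply, inputMemory])
    ((ht_natCast _).trans (by simp only [cap]; omega)) fun hF => ?_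
  refine Run.setS_seq h.cap_le hF (q := (1600 * (n + m) ^ 6 : ℕ)) ?_
    ((ht_natCast _).trans (by simp only [cap]; omega)) fun hF => ?_
  · simp only [Expr.eval, Expr.eval_rd, Memory.set_apply, and_self, if_true]
    push_cast
    ring
  · refine Run.skip hF ⟨?_, ?_, ?_, fun k => ⟨?_, ?_, ?_⟩⟩ <;>
      simp +contextual [Memory.set_apply, inputMemory]

theorem run_unit [NeZero n] (h : Caps n m B I U S K L) {V : Fin n → Finset (Fin m) → ℚ}
    (hV : ∀ i, IsXOSValuation (V i))
    (hX : ∀ i, IsXOSOracle (V i) (O.xos i)) (hB : ∀ i S, ∀ j ∈ S, bitSize (O.xos i S j) ≤ B)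
    (hσ : Fits (cap I U B S) σ) (hm : σ 1 0 = m) (hn : σ 2 0 = n) (hq : ∀ k, σ 6 k = 0) :
    Run O (cap I U B S) K L unitProg σ fun τ =>
      Same [4, 6, 7, 8, 11, 12, 15, 16, 18] σ τ ∧ (∀ k, τ 6 k = 0) ∧ ∃ w : Fin n → ℚ, ∀ k,
        IsRank n (fun e => V k {e}) (w k) ∧ ht (w k) ≤ B + 1 ∧ τ 4 k = m * w k := by
  have hnI := h.n_le_I
  have hUB := h.B_le
  have hIL := h.L_le
  refine Run.mono (Run.for h.cap_le hσ h.n_le (by simp only [cap]; omega)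
    (fun j τ => Same [4, 6, 7, 8, 11, 12, 15, 16, 18] σ τ ∧ (∀ k, τ 6 k = 0) ∧
      ∀ k : Fin n, (k : ℕ) < j → ∃ w : ℚ,
        IsRank n (fun e => V k {e}) w ∧ ht w ≤ B + 1 ∧ τ 4 k = m * w)
    ⟨(Same.refl _ _).set (by decide), fun k => ?_, by simp⟩ ?_ ?_) ?_
  · rw [Memory.set_of_ne _ _ _ (by decide), hq]
  · rintro j τ ⟨hs, -⟩
    rw [hs 2 (by decide), hn]
  · rintro j hj τ hτ hv ⟨hs, hq, hold⟩
    refine Run.seq (run_row h hX hB hτ (by rw [hs 1 (by decide), hm]) hq (i := ⟨j, hj⟩) hv) ?_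
    rintro ρ hρ ⟨hsρ, hqρ, hrow⟩
    have hs₁ : Same [4, 6, 7, 8, 11, 12, 15, 16, 18] σ ρ := hs.trans hsρ (by decide) (by decide)
    refine Run.seq (run_rank h hρ (by rw [hs₁ 1 (by decide), hm]) (by rw [hs₁ 2 (by decide), hn])
      hrow fun e => (hV _).nonneg _) ?_
    rintro μ hμ ⟨hsμ, hrank⟩
    have hs₂ : Same [4, 6, 7, 8, 11, 12, 15, 16, 18] σ μ := hs₁.trans hsμ (by decide) (by decide)
    have hvμ : μ 12 0 = j := by rw [hsμ 12 (by decide), hsρ 12 (by decide), hv]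
    have h4 : μ 4 = τ 4 := by rw [hsμ 4 (by decide), hsρ 4 (by decide)]
    have hwB : ht (μ 11 0) ≤ B + 1 := by
      rcases hrank.attained with h0 | ⟨e, he, -⟩
      · rw [h0, ht_zero]; omega
      · rw [he, ← hrow]
        exact hρ 8 e
    have hval : (Expr.mul (.rd 1) (.rd 11)).eval μ = m * μ 11 0 := by
      simp only [Expr.eval, Expr.eval_rd, hs₂ 1 (by decide), hm]
    refine Run.assign h.cap_le hμ ?_ ?_
    · rw [hval]
      have h1 := ht_mul m (μ 11 0)
      have h2 := ht_natCast m
      simp only [cap]; omega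
    · rw [hval]
      simp only [Expr.eval_rd, hvμ, Nat.floor_natCast]
      refine ⟨by rw [Memory.set_of_ne _ _ _ (by decide), hvμ],
        (hs₂.set (by decide)).set (by decide), fun k => ?_, fun k hk => ?_⟩
      · rw [Memory.set_of_ne _ _ _ (by decide), Memory.set_of_ne _ _ _ (by decide),
          hsμ 6 (by decide), hqρ]
      · rw [Memory.set_of_ne _ _ _ (by decide), Memory.set_apply]
        rcases Nat.lt_succ_iff_lt_or_eq.1 hk with hk | hk
        · obtain ⟨w, hw⟩ := hold k hk
          refine ⟨w, ?_⟩
          rw [if_neg fun hc => hk.ne hc.2, h4]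
          exact hw
        · obtain rfl : k = ⟨j, hj⟩ := Fin.ext hk
          exact ⟨μ 11 0, hrank, hwB, by simp⟩
  · rintro τ hτ ⟨hs, hq, hall⟩
    choose w hw using fun k : Fin n => hall k k.2
    exact ⟨hs, hq, w, hw⟩

/-! ### The whole run -/

/-- The initial state satisfies the invariant. -/
theorem State.Inv.init [NeZero n] {V : Fin n → Finset (Fin m) → ℚ}
    (hV : ∀ i, IsXOSValuation (V i)) {w : Fin n → ℚ} (hw : ∀ k, 0 ≤ w k)
    (hm : ∀ k, mms (V k) n ≤ m * w k) :
    State.Inv V w (fun _ => 0) ⟨fun _ => 0, fun _ => 0, fun k => m * w k⟩ := by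
  refine ⟨fun _ => le_rfl, fun _ => zero_le_one, fun k T _ => by simpa using (hV k).nonneg T,
    fun k => by simp [State.load], fun e he => by simp at he, fun k => (hm k).trans ?_,
    fun k => by simp, fun k => Nat.zero_le _⟩
  have : 0 ≤ m * w k := mul_nonneg (Nat.cast_nonneg _) (hw k)
  dsimp only
  linarith

theorem run_main [NeZero n] (h : Caps n m B I U S K L) {V : Fin n → Finset (Fin m) → ℚ}
    (hV : ∀ i, IsXOSValuation (V i)) (hD : ∀ i, IsDemandOracle (V i) (O.demand i))
    (hX : ∀ i, IsXOSOracle (V i) (O.xos i)) (hB : ∀ i S, ∀ j ∈ S, bitSize (O.xos i S j) ≤ B) :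
    Run O (cap I U B S) K L mainProg (inputMemory n m) fun τ =>
      ∃ A : Fin m → Fin n, IsOutput τ A ∧ IsMMSAllocation (1 / 8) V A := by
  have hnI := h.n_le_I
  have hUB := h.B_le
  have hIL := h.L_le
  have hSle := h.S_le
  have hσ : Fits (cap I U B S) (inputMemory n m) := by
    intro x k
    unfold inputMemory
    split_ifs with h0 h1
    · rw [h0.1]
      exact (ht_natCast _).trans (by simp only [cap]; omega)
    · rw [h1.1]
      exact (ht_natCast _).trans (by simp only [cap]; omega)
    · rw [ht_zero]
      unfold cap
      split <;> omega
  refine Run.seq (run_const h hσ) ?_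
  rintro τ₁ hτ₁ ⟨hm₁, hn₁, hN₁, hz₁⟩
  refine Run.seq (run_unit h hV hX hB hτ₁ hm₁ hn₁ fun k => (hz₁ k).2.2) ?_
  rintro τ₂ hτ₂ ⟨hs₂, hq₂, w, hw⟩
  have hw0 : ∀ k, 0 ≤ w k := fun k => (hw k).1.nonneg
  have hwm : ∀ k, w k ≤ mms (V k) n := fun k => (hw k).1.le_mms (hV k)
  have hinit := State.Inv.init hV hw0 fun k => (hw k).1.mms_le (hX k)
  have hst : Holds ⟨fun _ => 0, fun _ => 0, fun k => m * w k⟩ τ₂ :=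
    ⟨fun e => by rw [hs₂ 0 (by decide), (hz₁ e).1]; simp,
      fun e => by rw [hs₂ 5 (by decide), (hz₁ e).2.1], fun k => (hw k).2.2,
      by rw [hs₂ 1 (by decide), hm₁], by rw [hs₂ 2 (by decide), hn₁], hq₂⟩
  -- Each round raises `(2n+1)` times the potential by at least 1, so after `j` rounds it is at
  -- least `j` unless all agents are satisfied. Satisfied states are left unchanged, which lets the
  -- number of rounds be fixed in advance.
  refine Run.mono (Run.for h.cap_le hτ₂ h.N_le
    (by have := h.N_le; simp only [cap]; omega)
    (fun j τ => τ 3 0 = (1600 * (n + m) ^ 6 : ℕ) ∧ ∃ (st : State n m) (f : Fin n → ℕ),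
      Holds st τ ∧ State.Inv V w f st ∧
        ((∀ k, ¬ st.Unsat k) ∨ j ≤ (2 * n + 1) * st.potential f))
    ⟨?_, _, _, hst.of_same (X := [14]) ((Same.refl _ _).set (by decide)) (by decide) (by decide)
      (by decide) (by decide) (by decide) fun k => ?_, hinit, .inr ?_⟩ ?_ ?_) ?_
  · rw [Memory.set_of_ne _ _ _ (by decide), hs₂ 3 (by decide), hN₁]
  · rw [Memory.set_of_ne _ _ _ (by decide), hq₂]
  · simp only [State.potential, Nat.cast_zero, Finset.sum_const_zero, mul_zero, zero_add, add_zero]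
    positivity
  · rintro j τ ⟨h3, -⟩
    exact h3
  · rintro j hj τ hτ hv ⟨h3, st, f, hst, hI, hor⟩
    refine (run_round h hV hD hX hB hw0 (fun k => (hw k).2.1) hI hτ hst).mono ?_
    rintro ρ hρ ⟨hs, st', hst', hstep⟩
    have hset : Holds st' (ρ.set 14 0 (j + 1 : ℕ)) :=
      hst'.of_same (X := [14]) ((Same.refl _ _).set (by decide)) (by decide) (by decide)
        (by decide) (by decide) (by decide) fun k => by
          rw [Memory.set_of_ne _ _ _ (by decide), hst'.query]
    refine ⟨by rw [hs 14 (by decide), hv], ?_, st', ?_⟩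
    · rw [Memory.set_of_ne _ _ _ (by decide), hs 3 (by decide), h3]
    · rcases hstep with ⟨rfl, hsat⟩ | hstep
      · exact ⟨f, hset, hI, .inl hsat⟩
      · obtain ⟨f', hI', hpot⟩ := hI.step hw0 hwm hV hstep
        refine ⟨f', hset, hI', .inr ?_⟩
        have hle : (j : ℚ) ≤ (2 * n + 1) * st.potential f := by
          refine hor.resolve_left fun hsat => ?_
          obtain ⟨i, hi, -⟩ := hstep
          exact hsat i hi
        have hn : (0 : ℚ) < 2 * n + 1 := by positivity
        have := mul_le_mul_of_nonneg_left hpot hn.le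
        rw [mul_add, mul_one_div_cancel hn.ne'] at this
        push_cast
        linarith
  · rintro τ hτ ⟨-, st, f, hst, hI, hor⟩
    -- The number of rounds exceeds what the bound on the potential allows, so the search has
    -- succeeded.
    refine ⟨st.own, hst.own, hI.isMMSAllocation (hor.resolve_right fun hc => ?_)⟩
    have := hI.potential_lt
    push_cast at hc
    linarith

end Verification

/-! ### Polynomial bounds and conclusion -/

open Polynomial in
/-- All bounds can be chosen polynomial in the size of the input. -/
theorem exists_caps : ∃ q : Polynomial ℕ, ∀ n m B : ℕ, ∃ I U S K L : ℕ,
    Caps n m B I U S K L ∧ K + L ≤ q.eval (n + m + B) := by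
  let Lp : ℕ[X] := 1600 * X ^ 6 + X
  let Ip : ℕ[X] := Lp + X + 2
  let Up : ℕ[X] := X + 3 + (64 * X * X + 1) * (8 * X + 1)
  let Sp : ℕ[X] := X * (2 * Up + X + 5) + X + 2
  let Kp : ℕ[X] := Ip + 3 * Up + Sp + X + 12
  refine ⟨Kp + Lp, fun n m B => ?_⟩
  obtain ⟨s, hs⟩ : ∃ s, s = n + m + B := ⟨_, rfl⟩
  rw [← hs]
  have hL : Lp.eval s = 1600 * s ^ 6 + s := by simp [Lp]
  have hI : Ip.eval s = Lp.eval s + s + 2 := by simp [Ip]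
  have hU : Up.eval s = s + 3 + (64 * s * s + 1) * (8 * s + 1) := by simp [Up]
  have hS : Sp.eval s = s * (2 * Up.eval s + s + 5) + s + 2 := by simp [Sp]
  have hK : Kp.eval s = Ip.eval s + 3 * Up.eval s + Sp.eval s + s + 12 := by simp [Kp]
  refine ⟨Ip.eval s, Up.eval s, Sp.eval s, Kp.eval s, Lp.eval s,
    ⟨by omega, by omega, by omega, by omega, ?_, ?_, ?_, fun x => ?_⟩, (eval_add).ge⟩
  · rw [hL]
    have : (n + m) ^ 6 ≤ s ^ 6 := Nat.pow_le_pow_left (by omega) 6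
    omega
  · rw [hU]
    have : (64 * n * m + 1) * (8 * n + 1) ≤ (64 * s * s + 1) * (8 * s + 1) := by
      gcongr <;> omega
    omega
  · rw [hS]
    have : m * (2 * Up.eval s + B + 4 + 1) ≤ s * (2 * Up.eval s + s + 5) :=
      Nat.mul_le_mul (by omega) (by omega)
    omega
  · unfold cap
    split <;> omega

end FairAllocation

theorem mainTheorem8 :
    ∃ (c : FairAllocation.Program) (p : Polynomial ℕ),
      ∀ (n m B : ℕ) [NeZero n] (V : Fin n → Finset (Fin m) → ℚ) (O : FairAllocation.Oracles n m),
        (∀ i, FairAllocation.IsXOSValuation (V i)) →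
        (∀ i, FairAllocation.IsDemandOracle (V i) (O.demand i)) →
        (∀ i, FairAllocation.IsXOSOracle (V i) (O.xos i)) →
        (∀ i S, ∀ j ∈ S, FairAllocation.bitSize (O.xos i S j) ≤ B) →
        ∃ (t : ℕ) (τ : FairAllocation.Memory) (A : Fin m → Fin n),
          FairAllocation.Exec O c (FairAllocation.inputMemory n m) t τ ∧
          t ≤ p.eval (n + m + B) ∧
          FairAllocation.IsOutput τ A ∧
          FairAllocation.IsMMSAllocation (1 / 8) V A := by
  obtain ⟨p, hp⟩ := FairAllocation.mainProg.exists_time_le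
  obtain ⟨q, hq⟩ := FairAllocation.exists_caps
  -- `p` bounds the time in terms of `K + L`, and `q` bounds `K + L` in terms of the input.
  refine ⟨FairAllocation.mainProg, p.comp q, fun n m B _ V O hV hD hX hB => ?_⟩
  obtain ⟨I, U, S, K, L, hcaps, hKL⟩ := hq n m B
  obtain ⟨t, τ, hexec, ht, -, A, hout, hA⟩ := FairAllocation.run_main hcaps hV hD hX hB
  refine ⟨t, τ, A, hexec, ?_, hout, hA⟩
  rw [Polynomial.eval_comp]
  exact ht.trans ((hp K L).trans (FairAllocation.eval_mono p hKL))
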